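/- Let $N\ge 1$, let $E\subset\mathbb R^N$ be open, $T>0$, $E_T=E\times(0,T]$; local ("loc") statements refer to compact subsets of $E$ and $E_T$ and to intervals $[t_1,t_2]\subset(0,T]$. For $\rho>0$ let $K_\rho(y)$ be the (closed) cube with centre $y$ and edge $\rho$. Let $u\ge 0$ be measurable and locally bounded in $E_T$, with $$u\in L^r_{\rm loc}(E_T)\ \text{ for some } r>\max\{1,\tfrac N2\},\qquad \ln u\in L^\infty_{\rm loc}\big(0,T;L^p_{\rm loc}(E)\big),$$ where $\ln 0=-\infty$, so that $u>0$ a.e. For a cylinder $K_{2\rho}(y)\times[s,t]\subset E_T$ with $\rho>0$, $s<t$, put $$M=\operatorname*{ess\,sup}_{K_{2\rho}(y)\times(s,t]}u,\qquad \Lambda_q=\operatorname*{ess\,sup}_{s\le\tau\le t}\Big(\frac1{|K_{2\rho}(y)|}\int_{K_{2\rho}(y)}\Big|\ln\frac{u(x,\tau)}{M}\Big|^q dx\Big)^{1/q}.$$ (i) Let $p\ge2$, and let $u$ be a local weak solution of $u_t-\Delta\ln u=0$ in $E_T$, that is, $u\in C_{\rm loc}(0,T;L^2_{\rm loc}(E))$,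 $\ln u\in L^2_{\rm loc}(0,T;W^{1,2}_{\rm loc}(E))$, and, with $F=D\ln u$, $$\int_E u\varphi\,dx\Big|_{t_1}^{t_2}+\int_{t_1}^{t_2}\!\!\int_E\big(-u\varphi_t+F\cdot D\varphi\big)dx\,d\tau=0$$ for all $0<t_1<t_2\le T$ and all $\varphi\in C_c^\infty(E\times\mathbb R)$. Then there is a constant $\gamma>0$, depending only on $N,r,p,\Lambda_1,\Lambda_2$, such that for all cylinders $K_{2\rho}(y)\times[s,t]\subset E_T$ $$\sup_{s<\tau<t}\int_{K_\rho(y)}u(x,\tau)\,dx\le\gamma\Big(\inf_{s<\tau<t}\int_{K_{2\rho}(y)}u(x,\tau)\,dx+\frac{t-s}{\rho^{\lambda}}\Big),\qquad\lambda=2-N.$$ (ii) Let $C_o,C_1>0$ and let $A:E_T\times\mathbb R\times\mathbb R^N\to\mathbb R^N$ be (Borel) measurable such that, for a.e. $(x,t)\in E_T$, all $v>0$ and all $\xi\in\mathbb R^N$, $A(x,t,v,\xi)\cdot\xi\ge C_o|\xi|^2/v$ and $|A(x,t,v,\xi)|\le C_1|\xi|/v$. The same estimate holds if $p\ge2$ and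 $u$ is a local weak solution of $u_t-\operatorname{div}A(x,t,u,Du)=0$ in $E_T$ (same function spaces and identity as in (i), with $F=A(x,t,u,Du)$, $Du=u\,D\ln u$), with $\gamma$ depending only on $N,r,p,C_o,C_1,\Lambda_1,\Lambda_2$. (iii) Let $p>1$ and let $u$ be merely a distributional solution of $u_t-\Delta\ln u=0$, that is, $u,\ln u\in L^1_{\rm loc}(E_T)$ and $\iint(u\varphi_t+\ln u\,\Delta\varphi)\,dx\,d\tau=0$ for all $\varphi\in C_c^\infty(E\times(0,T))$. Then the same estimate holds, with $\sup$ and $\inf$ over $\tau$ read as essential supremum and essential infimum, and with $\gamma$ depending only on $N$ and $\Lambda_p$. -/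

import Mathlib

open MeasureTheory Set Filter Topology
open scoped ENNReal ContDiff

noncomputable section

namespace LogDiffusion

/-- The space `ℝ^N` with its Euclidean structure. -/
abbrev Sp (N : ℕ) : Type := EuclideanSpace ℝ (Fin N)

variable {N : ℕ}

/-- The space-time cylinder `E_T = E × (0, T]`. -/
def cyl (E : Set (Sp N)) (T : ℝ) : Set (Sp N × ℝ) := E ×ˢ Ioc 0 T

/-- The (closed) cube `K_ρ(y)` centred at `y`, with edge `ρ`. -/
def cube (y : Sp N) (ρ : ℝ) : Set (Sp N) := {x | ∀ i, |x i - y i| ≤ ρ / 2}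

/-- `f ∈ L^q_loc(E_T)`: `f` is in `L^q` of every compact subset of `E_T = E × (0, T]`.
For `q = ∞` this is local (essential) boundedness. -/
def MemLpLoc {F : Type*} [NormedAddCommGroup F] (E : Set (Sp N)) (T : ℝ) (f : Sp N → ℝ → F)
    (q : ℝ≥0∞) : Prop :=
  ∀ Q : Set (Sp N × ℝ), IsCompact Q → Q ⊆ cyl E T →
    MemLp (fun z : Sp N × ℝ => f z.1 z.2) q (volume.restrict Q)

/-- `u ∈ C_loc(0, T; L^2_loc(E))`: for every compact `K ⊆ E`, the map `τ ↦ u(·, τ)` is continuous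
from `(0, T]` to `L^2(K)`. -/
def MemCLoc (E : Set (Sp N)) (T : ℝ) (u : Sp N → ℝ → ℝ) : Prop :=
  ∀ K : Set (Sp N), IsCompact K → K ⊆ E →
    (∀ τ ∈ Ioc 0 T, MemLp (fun x => u x τ) 2 (volume.restrict K)) ∧
    ∀ τ₀ ∈ Ioc 0 T,
      Tendsto (fun τ => eLpNorm (fun x => u x τ - u x τ₀) 2 (volume.restrict K))
        (𝓝[Ioc 0 T] τ₀) (𝓝 0)

/-- `w ∈ L^∞_loc(0, T; L^p_loc(E))`: `w` is measurable on `E_T`, and for every compact `K ⊆ E` and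
every `[t₁, t₂] ⊆ (0, T]` the norm `‖w(·, τ)‖_{L^p(K)}` is essentially bounded for
`τ ∈ [t₁, t₂]`. -/
def MemLinftyLpLoc (E : Set (Sp N)) (T : ℝ) (w : Sp N → ℝ → ℝ) (p : ℝ) : Prop :=
  AEStronglyMeasurable (fun z : Sp N × ℝ => w z.1 z.2) (volume.restrict (cyl E T)) ∧
  ∀ K : Set (Sp N), IsCompact K → K ⊆ E → ∀ t₁ t₂ : ℝ, 0 < t₁ → t₂ ≤ T →
    essSup (fun τ => eLpNorm (fun x => w x τ) (ENNReal.ofReal p) (volume.restrict K))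
      (volume.restrict (Icc t₁ t₂)) < (⊤ : ℝ≥0∞)

/-- `g` is the weak gradient of `w` in the open set `E`. -/
def IsWeakGradient (E : Set (Sp N)) (w : Sp N → ℝ) (g : Sp N → Sp N) : Prop :=
  ∀ φ : Sp N → ℝ, ContDiff ℝ ∞ φ → HasCompactSupport φ → tsupport φ ⊆ E →
    ∫ x in E, w x • gradient φ x = - ∫ x in E, φ x • g x

/-- `w ∈ L^2_loc(0, T; W^{1,2}_loc(E))`, with weak spatial gradient `G`. -/
structure MemL2W12Loc (E : Set (Sp N)) (T : ℝ) (w : Sp N → ℝ → ℝ) (G : Sp N → ℝ → Sp N) :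
    Prop where
  memLp : MemLpLoc E T w 2
  memLp_grad : MemLpLoc E T G 2
  weakGradient : ∀ᵐ τ ∂(volume.restrict (Ioc 0 T)),
    IsWeakGradient E (fun x => w x τ) (fun x => G x τ)

/-- `u ≥ 0` a.e. in `E_T`, and `ln u` is a.e. finite, that is, `u ≠ 0` a.e. in `E_T`. (The latter is
part of any assertion that `ln u`, with `ln 0 = -∞`, is locally integrable; it has to be stated
because `Real.log 0 = 0`.) -/
structure NonnegLogFinite (E : Set (Sp N)) (T : ℝ) (u : Sp N → ℝ → ℝ) : Prop where
  nonneg : ∀ᵐ z ∂(volume.restrict (cyl E T)), 0 ≤ u z.1 z.2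
  ne_zero : ∀ᵐ z ∂(volume.restrict (cyl E T)), u z.1 z.2 ≠ 0

/-- `u_t - div F = 0` weakly in `E_T`: for all `0 < t₁ < t₂ ≤ T` and all test functions `φ`
that are smooth on `E × ℝ`, with compact support there,
`∫_E u φ dx |_{t₁}^{t₂} + ∫_{t₁}^{t₂} ∫_E (- u φ_t + F · Dφ) dx dτ = 0`. -/
def WeakEquation (E : Set (Sp N)) (T : ℝ) (u : Sp N → ℝ → ℝ) (F : Sp N → ℝ → Sp N) : Prop :=
  ∀ φ : Sp N × ℝ → ℝ, ContDiff ℝ ∞ φ → HasCompactSupport φ → tsupport φ ⊆ E ×ˢ univ →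
    ∀ t₁ t₂ : ℝ, 0 < t₁ → t₁ < t₂ → t₂ ≤ T →
      (∫ x in E, u x t₂ * φ (x, t₂)) - (∫ x in E, u x t₁ * φ (x, t₁))
        + ∫ z in E ×ˢ Ioc t₁ t₂,
            (- u z.1 z.2 * deriv (fun τ => φ (z.1, τ)) z.2
              + inner ℝ (F z.1 z.2) (gradient (fun x => φ (x, z.2)) z.1)) = 0

/-- Non-negative local weak solutions of `u_t - Δ ln u = 0` in `E_T`. -/
structure IsLocalWeakSolution (E : Set (Sp N)) (T : ℝ) (u : Sp N → ℝ → ℝ) : Prop where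
  nonnegLogFinite : NonnegLogFinite E T u
  memCLoc : MemCLoc E T u
  exists_grad : ∃ G : Sp N → ℝ → Sp N,
    MemL2W12Loc E T (fun x τ => Real.log (u x τ)) G ∧ WeakEquation E T u G

/-- The structure conditions on the field `A(x, t, v, ξ)`: it is (Borel) measurable and, for a.e.
`(x, t) ∈ E_T`, all `v > 0` and all `ξ ∈ ℝ^N`, `A · ξ ≥ C_o |ξ|² / v` and
`|A| ≤ C_1 |ξ| / v`. (Only the values of `A` for `(x, t) ∈ E_T` and `v > 0` matter; elsewhere `A` can
be taken to be `0`.) -/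
structure StructureConditions (E : Set (Sp N)) (T : ℝ) (A : Sp N → ℝ → ℝ → Sp N → Sp N)
    (Co C1 : ℝ) : Prop where
  measurable : Measurable (fun q : Sp N × ℝ × ℝ × Sp N => A q.1 q.2.1 q.2.2.1 q.2.2.2)
  coercive : ∀ᵐ z ∂(volume.restrict (cyl E T)), ∀ v : ℝ, 0 < v → ∀ ξ : Sp N,
    Co * (‖ξ‖ ^ 2 / v) ≤ inner ℝ (A z.1 z.2 v ξ) ξ
  growth : ∀ᵐ z ∂(volume.restrict (cyl E T)), ∀ v : ℝ, 0 < v → ∀ ξ : Sp N,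
    ‖A z.1 z.2 v ξ‖ ≤ C1 * (‖ξ‖ / v)

/-- Non-negative local weak solutions of `u_t - div A(x, t, u, Du) = 0` in `E_T`. Here
`Du = u D(ln u)`, where `D(ln u)` is the weak gradient of `ln u ∈ L^2_loc(0, T; W^{1,2}_loc(E))`. -/
structure IsLocalWeakSolutionQuasilinear (E : Set (Sp N)) (T : ℝ)
    (A : Sp N → ℝ → ℝ → Sp N → Sp N) (u : Sp N → ℝ → ℝ) : Prop where
  nonnegLogFinite : NonnegLogFinite E T u
  memCLoc : MemCLoc E T u
  exists_grad : ∃ G : Sp N → ℝ → Sp N,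
    MemL2W12Loc E T (fun x τ => Real.log (u x τ)) G ∧
    WeakEquation E T u (fun x τ => A x τ (u x τ) (u x τ • G x τ))

/-- Non-negative distributional solutions of `u_t - Δ ln u = 0` in `E_T`: `u` and `ln u` are merely
in `L^1_loc(E_T)`, and `∫∫ (u φ_t + ln u Δφ) dx dτ = 0` for all
`φ ∈ C_c^∞(E × (0, T))`. -/
structure IsDistributionalSolution (E : Set (Sp N)) (T : ℝ) (u : Sp N → ℝ → ℝ) : Prop where
  nonnegLogFinite : NonnegLogFinite E T u
  memLp : MemLpLoc E T u 1
  memLp_log : MemLpLoc E T (fun x τ => Real.log (u x τ)) 1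
  equation : ∀ φ : Sp N × ℝ → ℝ, ContDiff ℝ ∞ φ → HasCompactSupport φ →
    tsupport φ ⊆ E ×ˢ Ioo 0 T →
      ∫ z in E ×ˢ Ioo 0 T,
        (u z.1 z.2 * deriv (fun τ => φ (z.1, τ)) z.2
          + Real.log (u z.1 z.2) * Laplacian.laplacian (fun x => φ (x, z.2)) z.1) = 0

/-- `M = ess sup` of `u` over `K_{2ρ}(y) × (s, t]`. -/
def supM (u : Sp N → ℝ → ℝ) (y : Sp N) (ρ s t : ℝ) : ℝ :=
  (essSup (fun z : Sp N × ℝ => ENNReal.ofReal (u z.1 z.2))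
    (volume.restrict (cube y (2 * ρ) ×ˢ Ioc s t))).toReal

/-- `Λ_q = ess sup_{s ≤ τ ≤ t} (⨍_{K_{2ρ}(y)} |ln (u(x, τ) / M)|^q dx)^{1/q}`. -/
def Lam (u : Sp N → ℝ → ℝ) (y : Sp N) (ρ s t q : ℝ) : ℝ :=
  (essSup
    (fun τ => (⨍⁻ x in cube y (2 * ρ),
      ENNReal.ofReal |Real.log (u x τ / supM u y ρ s t)| ^ q ∂volume) ^ (1 / q))
    (volume.restrict (Icc s t))).toReal

/-- `∫_{K_ρ(y)} u(x, τ) dx`, as an element of `[0, ∞]`. -/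
def mass (u : Sp N → ℝ → ℝ) (y : Sp N) (ρ τ : ℝ) : ℝ≥0∞ :=
  ∫⁻ x in cube y ρ, ENNReal.ofReal (u x τ)

end LogDiffusion

end

/-!
Let `η` be a cutoff function equal to `1` on `K_ρ(y)` and supported in `K_{2ρ}(y)`, and let `M` be
the supremum of `u` on the cylinder.

For a weak solution put `w = ln (u / M)` and test the equation with `η² arctan w`. The flux is
comparable with `Dw`, and `D(arctan w) = Dw / (1 + w²)`, so this bounds `∬ η² |Dw|² / (1 + w²)` by
the supremum in time of `∫ η² u` plus `∬ (1 + w²) |Dη|²`, where the last integral is controlled by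
`Λ₂`. By Young's inequality the total flux `∬ |Dw| η |Dη|` is then at most a small multiple of the
supremum of `∫ η² u` plus a multiple of `∬ (1 + w²) |Dη|²`. Testing with `η²` alone shows that this
total flux controls the difference of `∫ η² u` at any two times, and the small multiple is absorbed.
As `u` need not be weakly differentiable in time, the first step is carried out for Steklov
averages; convexity of the primitive of `arctan ∘ ln` gives the inequality in the right direction.

For a distributional solution the weak time derivative of `∫ η u` is `∫ ln u Δη`, which equals
`∫ ln (u / M) Δη` because `∫ Δη = 0`. It is therefore bounded by `Λ_p` times a power of `ρ`, and
`∫ η u` is Lipschitz in time up to a null set.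
-/

namespace LogDiffusion

section SquareIntegrable

variable {α F : Type*} [MeasurableSpace α] {μ : Measure α} [NormedAddCommGroup F]

lemma eLpNorm_two_sq (f : α → F) : eLpNorm f 2 μ ^ 2 = ∫⁻ a, ‖f a‖ₑ ^ 2 ∂μ := by
  simpa using eLpNorm_nnreal_pow_eq_lintegral (μ := μ) (f := f) (p := 2) two_ne_zero

lemma memLp_two_iff_lintegral_lt_top {f : α → F} (hf : AEStronglyMeasurable f μ) :
    MemLp f 2 μ ↔ ∫⁻ a, ‖f a‖ₑ ^ 2 ∂μ < ⊤ := by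
  rw [← eLpNorm_two_sq, ENNReal.pow_lt_top_iff]
  exact ⟨fun h => Or.inl h.2, fun h => ⟨hf, h.resolve_right two_ne_zero⟩⟩

section Sections

variable {β : Type*} [MeasurableSpace β] {ν : Measure β} [SFinite ν]

lemma ae_memLp_two_prodMk_left {g : α × β → F} (hg : MemLp g 2 (μ.prod ν)) :
    ∀ᵐ x ∂μ, MemLp (fun y => g (x, y)) 2 ν := by
  have hfin := (memLp_two_iff_lintegral_lt_top hg.1).1 hg
  rw [lintegral_prod _ (hg.1.enorm.pow_const 2)] at hfin
  filter_upwards [ae_lt_top' (hg.1.enorm.pow_const 2).lintegral_prod_right' hfin.ne,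
    hg.1.prodMk_left] with x hx hm
  exact (memLp_two_iff_lintegral_lt_top hm).2 hx

lemma ae_memLp_two_prodMk_right [SFinite μ] {g : α × β → F} (hg : MemLp g 2 (μ.prod ν)) :
    ∀ᵐ y ∂ν, MemLp (fun x => g (x, y)) 2 μ :=
  ae_memLp_two_prodMk_left (hg.comp_measurePreserving Measure.measurePreserving_swap)

end Sections

lemma enorm_integral_sub_const_sq_le [NormedSpace ℝ F] [CompleteSpace F] [IsProbabilityMeasure μ]
    {f : α → F} (hf : AEStronglyMeasurable f μ) (c : F) :
    ‖(∫ a, f a ∂μ) - c‖ₑ ^ 2 ≤ ∫⁻ a, ‖f a - c‖ₑ ^ 2 ∂μ := by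
  rcases eq_top_or_lt_top (∫⁻ a, ‖f a - c‖ₑ ^ 2 ∂μ) with htop | hfin
  · exact htop ▸ le_top
  have hm : AEStronglyMeasurable (fun a => f a - c) μ := hf.sub aestronglyMeasurable_const
  have hfc : Integrable (fun a => f a - c) μ :=
    ((memLp_two_iff_lintegral_lt_top hm).2 hfin).integrable one_le_two
  have hfi : Integrable f μ :=
    (hfc.add (integrable_const c)).congr (ae_of_all _ fun a => by simp)
  calc ‖(∫ a, f a ∂μ) - c‖ₑ ^ 2 = ‖∫ a, (f a - c) ∂μ‖ₑ ^ 2 := by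
        rw [integral_sub hfi (integrable_const c), integral_const, probReal_univ, one_smul]
    _ ≤ eLpNorm (fun a => f a - c) 1 μ ^ 2 := by
        rw [eLpNorm_one_eq_lintegral_enorm]
        gcongr
        exact enorm_integral_le_lintegral_enorm _
    _ ≤ eLpNorm (fun a => f a - c) 2 μ ^ 2 := by
        gcongr
        exact eLpNorm_le_eLpNorm_of_exponent_le one_le_two hm
    _ = ∫⁻ a, ‖f a - c‖ₑ ^ 2 ∂μ := eLpNorm_two_sq _

lemma tendsto_eLpNorm_two_sub_of_dominated {f : ℕ → α → F} {g : α → F} {B : α → ℝ}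
    (hf : ∀ n, AEStronglyMeasurable (f n) μ) (hg : AEStronglyMeasurable g μ) (hB : MemLp B 2 μ)
    (hfB : ∀ n, ∀ᵐ a ∂μ, ‖f n a‖ ≤ B a)
    (hlim : ∀ᵐ a ∂μ, Tendsto (fun n => f n a) atTop (𝓝 (g a))) :
    Tendsto (fun n => eLpNorm (f n - g) 2 μ) atTop (𝓝 0) := by
  have hgB : ∀ᵐ a ∂μ, ‖g a‖ ≤ B a := by
    filter_upwards [hlim, ae_all_iff.2 hfB] with a ha hb
    exact le_of_tendsto ha.norm (Eventually.of_forall hb)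
  have hdom : ∀ n, ∀ᵐ a ∂μ, ‖(f n - g) a‖ₑ ^ 2 ≤ ‖(B + B) a‖ₑ ^ 2 := fun n => by
    filter_upwards [hfB n, hgB] with a h1 h2
    gcongr
    exact enorm_le_iff_norm_le.2 ((norm_sub_le _ _).trans ((add_le_add h1 h2).trans
      (le_abs_self _)))
  have hsq : Tendsto (fun n => ∫⁻ a, ‖(f n - g) a‖ₑ ^ 2 ∂μ) atTop (𝓝 (∫⁻ _, 0 ∂μ)) := by
    refine tendsto_lintegral_of_dominated_convergence' _
      (fun n => ((hf n).sub hg).enorm.pow_const 2) hdom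
      ((memLp_two_iff_lintegral_lt_top (hB.add hB).1).1 (hB.add hB)).ne ?_
    filter_upwards [hlim] with a ha
    simpa using ENNReal.Tendsto.pow (n := 2) (tendsto_iff_enorm_sub_tendsto_zero.1 ha)
  rw [lintegral_zero] at hsq
  refine ENNReal.tendsto_nhds_zero.2 fun ε hε => ?_
  filter_upwards [ENNReal.tendsto_nhds_zero.1 hsq (ε ^ 2) (ENNReal.pow_pos hε 2)] with n hn
  rwa [← eLpNorm_two_sq, ENNReal.pow_le_pow_left_iff two_ne_zero] at hn

variable [InnerProductSpace ℝ F] {a b : α → F}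

lemma integrable_inner_of_memLp (ha : MemLp a 2 μ) (hb : MemLp b 2 μ) :
    Integrable (fun x => inner ℝ (a x) (b x)) μ := by
  refine (L2.integrable_inner (𝕜 := ℝ) (ha.toLp a) (hb.toLp b)).congr ?_
  filter_upwards [ha.coeFn_toLp, hb.coeFn_toLp] with x h1 h2
  rw [h1, h2]

lemma integral_inner_eq_inner_toLp (ha : MemLp a 2 μ) (hb : MemLp b 2 μ) :
    ∫ x, inner ℝ (a x) (b x) ∂μ = inner ℝ (ha.toLp a) (hb.toLp b) := by
  rw [L2.inner_def]
  refine integral_congr_ae ?_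
  filter_upwards [ha.coeFn_toLp, hb.coeFn_toLp] with x h1 h2
  rw [h1, h2]

lemma tendsto_integral_inner {aₙ bₙ : ℕ → α → F} (haₙ : ∀ n, MemLp (aₙ n) 2 μ) (ha : MemLp a 2 μ)
    (hbₙ : ∀ n, MemLp (bₙ n) 2 μ) (hb : MemLp b 2 μ)
    (hlima : Tendsto (fun n => eLpNorm (aₙ n - a) 2 μ) atTop (𝓝 0))
    (hlimb : Tendsto (fun n => eLpNorm (bₙ n - b) 2 μ) atTop (𝓝 0)) :
    Tendsto (fun n => ∫ x, inner ℝ (aₙ n x) (bₙ n x) ∂μ) atTop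
      (𝓝 (∫ x, inner ℝ (a x) (b x) ∂μ)) := by
  simp only [fun n => integral_inner_eq_inner_toLp (haₙ n) (hbₙ n),
    integral_inner_eq_inner_toLp ha hb]
  exact ((Lp.tendsto_Lp_iff_tendsto_eLpNorm'' _ haₙ _ ha).2 hlima).inner
    ((Lp.tendsto_Lp_iff_tendsto_eLpNorm'' _ hbₙ _ hb).2 hlimb)

end SquareIntegrable

section Average

variable {V F : Type*} [NormedAddCommGroup V] [MeasurableSpace V] [BorelSpace V]
  [SecondCountableTopology V] [NormedAddCommGroup F] {μ : Measure V} [μ.IsAddLeftInvariant]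

lemma tendsto_eLpNorm_translate_sub [IsLocallyFiniteMeasure μ] [μ.InnerRegularCompactLTTop]
    {p : ℝ≥0∞} [Fact (1 ≤ p)] [hp : Fact (p ≠ ⊤)] {g : V → F} (hg : MemLp g p μ) :
    Tendsto (fun v => eLpNorm (fun z => g (z - v) - g z) p μ) (𝓝 0) (𝓝 0) := by
  have hc : Continuous (fun v : V => (DomAddAct.mk (-v) : Vᵈᵃᵃ) +ᵥ hg.toLp g) :=
    Continuous.vadd (DomAddAct.mkHomeomorph.continuous.comp continuous_neg) continuous_const
  have hlim := (hc.tendsto 0).edist (tendsto_const_nhds (x := hg.toLp g))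
  simp only [neg_zero, DomAddAct.mk_zero, zero_vadd, edist_self] at hlim
  refine hlim.congr fun v => ?_
  rw [DomAddAct.mk_vadd_toLp, Lp.edist_toLp_toLp]
  refine congrArg (eLpNorm · p μ) (funext fun z => ?_)
  simp [sub_eq_neg_add]

variable [SFinite μ] {g : V → F} {κ : Measure V}

lemma aestronglyMeasurable_translate [SFinite κ] (hg : AEStronglyMeasurable g μ) :
    AEStronglyMeasurable (fun q : V × V => g (q.1 - q.2)) (μ.prod κ) :=
  hg.comp_quasiMeasurePreserving <| QuasiMeasurePreserving.prod_of_left (by fun_prop) <|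
    ae_of_all _ fun v => (measurePreserving_sub_right μ v).quasiMeasurePreserving

variable [NormedSpace ℝ F] [CompleteSpace F] [IsProbabilityMeasure κ]

lemma eLpNorm_average_sub_le (hg : AEStronglyMeasurable g μ) {ε : ℝ≥0∞}
    (h : ∀ᵐ v ∂κ, eLpNorm (fun z => g (z - v) - g z) 2 μ ≤ ε) :
    eLpNorm (fun z => (∫ v, g (z - v) ∂κ) - g z) 2 μ ≤ ε := by
  have hm : AEStronglyMeasurable (fun q : V × V => g (q.1 - q.2) - g q.1) (μ.prod κ) :=
    (aestronglyMeasurable_translate hg).sub hg.comp_fst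
  rw [← ENNReal.pow_le_pow_left_iff two_ne_zero, eLpNorm_two_sq]
  calc ∫⁻ z, ‖(∫ v, g (z - v) ∂κ) - g z‖ₑ ^ 2 ∂μ
      ≤ ∫⁻ z, ∫⁻ v, ‖g (z - v) - g z‖ₑ ^ 2 ∂κ ∂μ := by
        refine lintegral_mono_ae ?_
        filter_upwards [(aestronglyMeasurable_translate (κ := κ) hg).prodMk_left] with z hz
        exact enorm_integral_sub_const_sq_le hz (g z)
    _ = ∫⁻ v, eLpNorm (fun z => g (z - v) - g z) 2 μ ^ 2 ∂κ := by
        simp only [eLpNorm_two_sq]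
        exact lintegral_lintegral_swap (hm.enorm.pow_const 2)
    _ ≤ ∫⁻ _, ε ^ 2 ∂κ := by
        refine lintegral_mono_ae (h.mono fun v hv => ?_)
        gcongr
    _ = ε ^ 2 := by simp

lemma memLp_average (hg : MemLp g 2 μ) : MemLp (fun z => ∫ v, g (z - v) ∂κ) 2 μ := by
  have htrans : ∀ v, MemLp (fun z => g (z - v)) 2 μ := fun v =>
    hg.comp_measurePreserving (measurePreserving_sub_right μ v)
  have hbound : ∀ v, eLpNorm (fun z => g (z - v) - g z) 2 μ ≤ eLpNorm g 2 μ + eLpNorm g 2 μ :=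
    fun v => (eLpNorm_sub_le (htrans v).1 hg.1 one_le_two).trans_eq <|
      congrArg (· + _) (eLpNorm_comp_measurePreserving hg.1 (measurePreserving_sub_right μ v))
  have hsub : MemLp (fun z => (∫ v, g (z - v) ∂κ) - g z) 2 μ :=
    ⟨(aestronglyMeasurable_translate hg.1).integral_prod_right'.sub hg.1,
      (eLpNorm_average_sub_le hg.1 (ae_of_all _ hbound)).trans_lt
        (ENNReal.add_lt_top.2 ⟨hg.2, hg.2⟩)⟩
  exact (hsub.add hg).ae_eq (ae_of_all _ fun z => by simp)

lemma tendsto_eLpNorm_average_sub [IsLocallyFiniteMeasure μ] [μ.InnerRegularCompactLTTop]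
    (hg : MemLp g 2 μ) {κ : ℕ → Measure V}
    [∀ n, IsProbabilityMeasure (κ n)] {δ : ℕ → ℝ} (hδ : Tendsto δ atTop (𝓝 0))
    (hκ : ∀ n, ∀ᵐ v ∂(κ n), ‖v‖ ≤ δ n) :
    Tendsto (fun n => eLpNorm (fun z => (∫ v, g (z - v) ∂(κ n)) - g z) 2 μ) atTop (𝓝 0) := by
  have : Fact ((2 : ℝ≥0∞) ≠ ⊤) := ⟨ENNReal.ofNat_ne_top⟩
  refine ENNReal.tendsto_nhds_zero.2 fun ε hε => ?_
  obtain ⟨r, hr, hball⟩ := Metric.eventually_nhds_iff.1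
    (ENNReal.tendsto_nhds_zero.1 (tendsto_eLpNorm_translate_sub hg) ε hε)
  filter_upwards [hδ.eventually (gt_mem_nhds hr)] with n hn
  refine eLpNorm_average_sub_le hg.1 ((hκ n).mono fun v hv => ?_)
  exact hball (by simpa using hv.trans_lt hn)

end Average

section TestFunction

variable {V : Type*} [NormedAddCommGroup V] [NormedSpace ℝ V]

/-- The admissible test functions on a set `K`: smooth functions with compact support in `K`. -/
structure IsTestFunction (K : Set V) (φ : V → ℝ) : Prop where
  contDiff : ContDiff ℝ ∞ φ
  hasCompactSupport : HasCompactSupport φ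
  tsupport_subset : tsupport φ ⊆ K

namespace IsTestFunction

variable {K L : Set V} {φ ζ : V → ℝ}

lemma mono (hφ : IsTestFunction K φ) (hKL : K ⊆ L) : IsTestFunction L φ :=
  ⟨hφ.contDiff, hφ.hasCompactSupport, hφ.tsupport_subset.trans hKL⟩

lemma eq_zero_of_notMem (hφ : IsTestFunction K φ) {x : V} (hx : x ∉ K) : φ x = 0 :=
  image_eq_zero_of_notMem_tsupport fun h => hx (hφ.tsupport_subset h)

lemma mul_left (hζ : IsTestFunction K ζ) (hφ : ContDiff ℝ ∞ φ) :
    IsTestFunction K (fun x => φ x * ζ x) :=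
  ⟨hφ.mul hζ.contDiff, hζ.hasCompactSupport.mul_left,
    tsupport_mul_subset_right.trans hζ.tsupport_subset⟩

lemma differentiable (hφ : IsTestFunction K φ) : Differentiable ℝ φ :=
  hφ.contDiff.differentiable (by simp)

lemma memLp [MeasurableSpace V] [OpensMeasurableSpace V] {μ : Measure V}
    [IsFiniteMeasureOnCompacts μ] {p : ℝ≥0∞} (hφ : IsTestFunction K φ) : MemLp φ p μ :=
  hφ.contDiff.continuous.memLp_of_hasCompactSupport hφ.hasCompactSupport

end IsTestFunction

end TestFunction

section Gradient

variable {V : Type*} [NormedAddCommGroup V] [InnerProductSpace ℝ V] [CompleteSpace V]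

lemma norm_gradient (φ : V → ℝ) (x : V) : ‖gradient φ x‖ = ‖fderiv ℝ φ x‖ :=
  (InnerProductSpace.toDual ℝ V).symm.norm_map _

lemma gradient_comp_mul {f : ℝ → ℝ} {w ζ : V → ℝ} {x : V} (hf : Differentiable ℝ f)
    (hw : DifferentiableAt ℝ w x) (hζ : DifferentiableAt ℝ ζ x) :
    gradient (fun x => f (w x) * ζ x) x =
      (deriv f (w x) * ζ x) • gradient w x + f (w x) • gradient ζ x := by
  have hfd : fderiv ℝ (fun x => f (w x) * ζ x) x = _ :=
    (((hf (w x)).hasDerivAt.comp_hasFDerivAt x hw.hasFDerivAt).mul hζ.hasFDerivAt).fderiv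
  refine ext_inner_right ℝ fun v => ?_
  simp only [inner_add_left, inner_smul_left, inner_gradient_left, hfd]
  simp
  ring

lemma gradient_comp_const_sub {ψ : V → ℝ} (hψ : Differentiable ℝ ψ) (x z : V) :
    gradient (fun z => ψ (x - z)) z = -gradient ψ (x - z) := by
  have hfd : fderiv ℝ (fun z => ψ (x - z)) z = _ :=
    ((hψ (x - z)).hasFDerivAt.comp z ((hasFDerivAt_id z).const_sub x)).fderiv
  refine ext_inner_right ℝ fun v => ?_
  simp [inner_gradient_left, hfd]

namespace IsTestFunction

variable {K : Set V} {φ : V → ℝ}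

lemma continuous_gradient (hφ : IsTestFunction K φ) : Continuous (gradient φ) :=
  (InnerProductSpace.toDual ℝ V).symm.continuous.comp (hφ.contDiff.continuous_fderiv (by simp))

lemma hasCompactSupport_gradient (hφ : IsTestFunction K φ) : HasCompactSupport (gradient φ) :=
  (hφ.hasCompactSupport.fderiv ℝ).comp_left (g := (InnerProductSpace.toDual ℝ V).symm)
    (map_zero _)

lemma memLp_gradient [MeasurableSpace V] [BorelSpace V] {μ : Measure V}
    [IsFiniteMeasureOnCompacts μ] {p : ℝ≥0∞} (hφ : IsTestFunction K φ) :
    MemLp (gradient φ) p μ :=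
  hφ.continuous_gradient.memLp_of_hasCompactSupport hφ.hasCompactSupport_gradient

end IsTestFunction

end Gradient

section Mollification

variable (V : Type*) [NormedAddCommGroup V]

/-- Bump functions whose supports shrink to `0`, the kernels of `moll`. -/
noncomputable def bump (n : ℕ) : ContDiffBump (0 : V) where
  rIn := 1 / (n + 1)
  rOut := 2 * (1 / (n + 1))
  rIn_pos := by positivity
  rIn_lt_rOut := lt_mul_of_one_lt_left (by positivity) one_lt_two

lemma tendsto_bump_rOut : Tendsto (fun n => (bump V n).rOut) atTop (𝓝 0) := by
  simpa [bump] using (tendsto_one_div_add_atTop_nhds_zero_nat (𝕜 := ℝ)).const_mul 2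

variable [InnerProductSpace ℝ V] [FiniteDimensional ℝ V] [MeasurableSpace V] [BorelSpace V]

/-- The probability measure whose density is the `n`-th bump function; mollification is averaging
over its translates. -/
noncomputable def mollMeasure (n : ℕ) : Measure V :=
  volume.withDensity fun x => ENNReal.ofReal ((bump V n).normed volume x)

lemma measurable_ofReal_bump (n : ℕ) :
    Measurable fun x => ENNReal.ofReal ((bump V n).normed volume x) :=
  (bump V n).continuous_normed.measurable.ennreal_ofReal

instance (n : ℕ) : IsProbabilityMeasure (mollMeasure V n) := by
  refine ⟨?_⟩
  rw [mollMeasure, withDensity_apply _ MeasurableSet.univ, Measure.restrict_univ,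
    ← ofReal_integral_eq_lintegral_ofReal (bump V n).integrable_normed
      (ae_of_all _ (bump V n).nonneg_normed), (bump V n).integral_normed, ENNReal.ofReal_one]

lemma ae_mollMeasure_norm_le (n : ℕ) : ∀ᵐ v ∂mollMeasure V n, ‖v‖ ≤ (bump V n).rOut := by
  refine (ae_withDensity_iff (measurable_ofReal_bump V n)).2 (ae_of_all _ fun v hv => ?_)
  have hsupp : v ∈ Function.support ((bump V n).normed volume) := fun h0 => hv (by simp [h0])
  rw [ContDiffBump.support_normed_eq] at hsupp
  exact (mem_ball_zero_iff.1 hsupp).le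

variable {V} {F : Type*} [NormedAddCommGroup F] [NormedSpace ℝ F]

/-- The standard mollification of a function. -/
noncomputable def moll (n : ℕ) (g : V → F) : V → F :=
  convolution ((bump V n).normed volume) g (ContinuousLinearMap.lsmul ℝ ℝ) volume

lemma moll_eq_average (n : ℕ) (g : V → F) :
    moll n g = fun x => ∫ v, g (x - v) ∂mollMeasure V n := by
  funext x
  rw [mollMeasure, integral_withDensity_eq_integral_toReal_smul (measurable_ofReal_bump V n)
    (by simp)]
  simp only [ENNReal.toReal_ofReal ((bump V n).nonneg_normed _)]
  rfl

lemma contDiff_moll {g : V → F} (hg : LocallyIntegrable g volume) (n : ℕ) :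
    ContDiff ℝ ∞ (moll n g) :=
  (bump V n).hasCompactSupport_normed.contDiff_convolution_left _ (bump V n).contDiff_normed hg

variable [CompleteSpace F] {g : V → F}

lemma ae_tendsto_moll (hg : LocallyIntegrable g volume) :
    ∀ᵐ x, Tendsto (fun n => moll n g x) atTop (𝓝 (g x)) :=
  ContDiffBump.ae_convolution_tendsto_right_of_locallyIntegrable (tendsto_bump_rOut V)
    (Eventually.of_forall fun _ => le_refl _) hg

lemma memLp_moll (hg : MemLp g 2 volume) (n : ℕ) : MemLp (moll n g) 2 volume := by
  rw [moll_eq_average]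
  exact memLp_average hg

lemma tendsto_eLpNorm_moll_sub (hg : MemLp g 2 volume) :
    Tendsto (fun n => eLpNorm (moll n g - g) 2 volume) atTop (𝓝 0) := by
  simp only [moll_eq_average]
  exact tendsto_eLpNorm_average_sub hg (tendsto_bump_rOut V) (ae_mollMeasure_norm_le V)

end Mollification

section WeakGradient

variable {V : Type*} [NormedAddCommGroup V] [InnerProductSpace ℝ V] [FiniteDimensional ℝ V]
  [MeasurableSpace V] [BorelSpace V]

/-- `g` is the weak gradient of `w` on `K`, tested with functions supported in `K`. Unlike
`IsWeakGradient`, the functions live on the whole space, so that they can be mollified. -/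
def IsWeakGradientOn (K : Set V) (w : V → ℝ) (g : V → V) : Prop :=
  ∀ φ, IsTestFunction K φ → ∫ x, w x • gradient φ x = -∫ x, φ x • g x

lemma gradient_convolution {ψ w : V → ℝ} (hψ : ContDiff ℝ ∞ ψ) (hψc : HasCompactSupport ψ)
    (hw : LocallyIntegrable w volume) (x : V) :
    gradient (convolution ψ w (ContinuousLinearMap.lsmul ℝ ℝ) volume) x =
      ∫ z, w z • gradient ψ (x - z) := by
  have hψK : IsTestFunction univ ψ := ⟨hψ, hψc, subset_univ _⟩
  have hfd := (hψc.hasFDerivAt_convolution_left (ContinuousLinearMap.lsmul ℝ ℝ)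
    (hψ.of_le (by exact_mod_cast le_top)) hw x).fderiv
  have hexists : ConvolutionExistsAt (fderiv ℝ ψ) w x
      ((ContinuousLinearMap.lsmul ℝ ℝ).precompL V) volume :=
    (hψc.fderiv ℝ).convolutionExists_left _ (hψ.continuous_fderiv (by simp)) hw x
  have hint : Integrable (fun z => w z • gradient ψ (x - z)) volume :=
    hw.integrable_smul_right_of_hasCompactSupport
      (hψK.continuous_gradient.comp (continuous_const.sub continuous_id))
      (hψK.hasCompactSupport_gradient.comp_homeomorph (Homeomorph.subLeft x))
  refine ext_inner_right ℝ fun v => ?_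
  rw [inner_gradient_left, hfd, convolution_def, ContinuousLinearMap.integral_apply hexists,
    real_inner_comm, ← integral_inner hint, ← integral_sub_left_eq_self _ volume x]
  refine integral_congr_ae (ae_of_all _ fun z => ?_)
  simp [inner_smul_right, mul_comm]

lemma isTestFunction_bump_translate {K : Set V} {n : ℕ} {x : V}
    (hx : Metric.closedBall x (bump V n).rOut ⊆ K) :
    IsTestFunction K fun z => (bump V n).normed volume (x - z) where
  contDiff := (bump V n).contDiff_normed.comp (contDiff_const.sub contDiff_id)
  hasCompactSupport :=
    (bump V n).hasCompactSupport_normed.comp_homeomorph (Homeomorph.subLeft x)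
  tsupport_subset := by
    refine (closure_minimal (fun z hz => ?_) Metric.isClosed_closedBall).trans hx
    have hsupp : x - z ∈ Function.support ((bump V n).normed volume) := hz
    rw [ContDiffBump.support_normed_eq, mem_ball_zero_iff] at hsupp
    rw [Metric.mem_closedBall, dist_comm, dist_eq_norm]
    exact hsupp.le

lemma IsWeakGradientOn.gradient_moll {w : V → ℝ} {g : V → V} {K : Set V}
    (hwg : IsWeakGradientOn K w g) (hw : LocallyIntegrable w volume) {n : ℕ} {x : V}
    (hx : Metric.closedBall x (bump V n).rOut ⊆ K) :
    gradient (moll n w) x = moll n g x := by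
  have hψ : ContDiff ℝ ∞ ((bump V n).normed volume) := (bump V n).contDiff_normed
  have htest := hwg _ (isTestFunction_bump_translate hx)
  simp only [gradient_comp_const_sub (hψ.differentiable (by simp)), smul_neg, integral_neg,
    neg_inj] at htest
  rw [moll, gradient_convolution hψ (bump V n).hasCompactSupport_normed hw, htest]
  exact convolution_lsmul_swap.symm

end WeakGradient

section AdmissibleTestFunction

/-- The nonlinearities `f` for which `f(w) ζ` is an admissible test function whenever `w` is weakly
differentiable. -/
structure SmoothBounded (f : ℝ → ℝ) (c c' : ℝ) : Prop where
  contDiff : ContDiff ℝ ∞ f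
  abs_le : ∀ a, |f a| ≤ c
  abs_deriv_le : ∀ a, |deriv f a| ≤ c'

namespace SmoothBounded

variable {f : ℝ → ℝ} {c c' : ℝ}

lemma continuous_deriv (hf : SmoothBounded f c c') : Continuous (deriv f) :=
  hf.contDiff.continuous_deriv (by simp)

lemma nonneg (hf : SmoothBounded f c c') : 0 ≤ c := (abs_nonneg _).trans (hf.abs_le 0)

lemma deriv_bound_nonneg (hf : SmoothBounded f c c') : 0 ≤ c' :=
  (abs_nonneg _).trans (hf.abs_deriv_le 0)

lemma memLp_comp_mul (hf : SmoothBounded f c c') {α : Type*} [MeasurableSpace α] {μ : Measure α}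
    {w ζ : α → ℝ} {p : ℝ≥0∞} (hw : AEStronglyMeasurable w μ) (hζ : MemLp ζ p μ) :
    MemLp (fun x => f (w x) * ζ x) p μ := by
  refine hζ.of_le_mul (c := c)
    ((hf.contDiff.continuous.comp_aestronglyMeasurable hw).mul hζ.1) (ae_of_all _ fun x => ?_)
  rw [norm_mul]
  gcongr
  exact hf.abs_le _

end SmoothBounded

variable {V : Type*} [NormedAddCommGroup V] [InnerProductSpace ℝ V] [CompleteSpace V]

/-- The gradient at `x` of the test function `f(w) ζ`, where `w` has the value `a` and the (weak)
gradient `b` at `x`. -/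
noncomputable def testGradient (f : ℝ → ℝ) (ζ : V → ℝ) (a : ℝ) (b x : V) : V :=
  (deriv f a * ζ x) • b + f a • gradient ζ x

variable {f : ℝ → ℝ} {c c' Z : ℝ} {ζ : V → ℝ} {K : Set V} {α : Type*} [MeasurableSpace α]
  {μ : Measure α} {w : α → ℝ} {g : α → V} {ξ : α → V}

lemma norm_testGradient_le (hf : SmoothBounded f c c') (hZ : ∀ x, ‖ζ x‖ ≤ Z) (a : ℝ) (b x : V) :
    ‖testGradient f ζ a b x‖ ≤ c' * Z * ‖b‖ + c * ‖gradient ζ x‖ := by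
  have hc' := hf.deriv_bound_nonneg
  refine (norm_add_le _ _).trans ?_
  rw [norm_smul, norm_mul, norm_smul]
  gcongr
  exacts [hf.abs_deriv_le _, hZ x, hf.abs_le _]

lemma norm_testGradient_sub_le (hf : SmoothBounded f c c') (hZ : ∀ x, ‖ζ x‖ ≤ Z) (a : ℝ)
    (b₁ b₂ x : V) :
    ‖testGradient f ζ a b₁ x - testGradient f ζ a b₂ x‖ ≤ c' * Z * ‖b₁ - b₂‖ := by
  have hc' := hf.deriv_bound_nonneg
  rw [testGradient, testGradient, add_sub_add_right_eq_sub, ← smul_sub, norm_smul, norm_mul]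
  gcongr
  exacts [hf.abs_deriv_le _, hZ x]

lemma aestronglyMeasurable_testGradient (hf : SmoothBounded f c c') (hζ : IsTestFunction K ζ)
    (hw : AEStronglyMeasurable w μ) (hg : AEStronglyMeasurable g μ)
    (hξ : AEStronglyMeasurable ξ μ) :
    AEStronglyMeasurable (fun a => testGradient f ζ (w a) (g a) (ξ a)) μ :=
  (((hf.continuous_deriv.comp_aestronglyMeasurable hw).mul
    (hζ.contDiff.continuous.comp_aestronglyMeasurable hξ)).smul hg).add
    ((hf.contDiff.continuous.comp_aestronglyMeasurable hw).smul
      (hζ.continuous_gradient.comp_aestronglyMeasurable hξ))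

lemma memLp_testGradient (hf : SmoothBounded f c c') (hζ : IsTestFunction K ζ)
    (hw : AEStronglyMeasurable w μ) (hg : MemLp g 2 μ) (hξ : AEStronglyMeasurable ξ μ)
    (hgradζ : MemLp (fun a => gradient ζ (ξ a)) 2 μ) :
    MemLp (fun a => testGradient f ζ (w a) (g a) (ξ a)) 2 μ := by
  obtain ⟨Z, hZ⟩ := hζ.hasCompactSupport.exists_bound_of_continuous hζ.contDiff.continuous
  exact ((hg.norm.const_mul (c' * Z)).add (hgradζ.norm.const_mul c)).mono'
    (aestronglyMeasurable_testGradient hf hζ hw hg.1 hξ)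
    (ae_of_all _ fun a => norm_testGradient_le hf hZ _ _ _)

lemma tendsto_eLpNorm_testGradient_sub (hf : SmoothBounded f c c') (hζ : IsTestFunction K ζ)
    {wₙ : ℕ → α → ℝ} {gₙ : ℕ → α → V} (hwₙ : ∀ n, AEStronglyMeasurable (wₙ n) μ)
    (hw : AEStronglyMeasurable w μ) (hgₙ : ∀ n, MemLp (gₙ n) 2 μ) (hg : MemLp g 2 μ)
    (hξ : AEStronglyMeasurable ξ μ) (hgradζ : MemLp (fun a => gradient ζ (ξ a)) 2 μ)
    (hlimw : ∀ᵐ a ∂μ, Tendsto (fun n => wₙ n a) atTop (𝓝 (w a)))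
    (hlimg : Tendsto (fun n => eLpNorm (gₙ n - g) 2 μ) atTop (𝓝 0)) :
    Tendsto (fun n => eLpNorm ((fun a => testGradient f ζ (wₙ n a) (gₙ n a) (ξ a)) -
      fun a => testGradient f ζ (w a) (g a) (ξ a)) 2 μ) atTop (𝓝 0) := by
  obtain ⟨Z, hZ⟩ := hζ.hasCompactSupport.exists_bound_of_continuous hζ.contDiff.continuous
  have hmeas n {b : α → V} (hb : MemLp b 2 μ) :
      AEStronglyMeasurable (fun a => testGradient f ζ (wₙ n a) (b a) (ξ a)) μ :=
    aestronglyMeasurable_testGradient hf hζ (hwₙ n) hb.1 hξ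
  have hmeas_lim := aestronglyMeasurable_testGradient hf hζ hw hg.1 hξ
  have hvalue : Tendsto (fun n => eLpNorm ((fun a => testGradient f ζ (wₙ n a) (g a) (ξ a)) -
      fun a => testGradient f ζ (w a) (g a) (ξ a)) 2 μ) atTop (𝓝 0) := by
    refine tendsto_eLpNorm_two_sub_of_dominated (fun n => hmeas n hg) hmeas_lim
      ((hg.norm.const_mul (c' * Z)).add (hgradζ.norm.const_mul c))
      (fun n => ae_of_all _ fun a => norm_testGradient_le hf hZ _ _ _) ?_
    filter_upwards [hlimw] with a ha
    exact ((((hf.continuous_deriv.tendsto _).comp ha).mul_const _).smul_const _).add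
      (((hf.contDiff.continuous.tendsto _).comp ha).smul_const _)
  have hgrad : Tendsto (fun n => ENNReal.ofReal (c' * Z) * eLpNorm (gₙ n - g) 2 μ) atTop (𝓝 0) := by
    simpa using ENNReal.Tendsto.const_mul hlimg (Or.inr ENNReal.ofReal_ne_top)
  refine tendsto_of_tendsto_of_tendsto_of_le_of_le tendsto_const_nhds
    (by simpa using hgrad.add hvalue) (fun _ => zero_le) fun n => ?_
  have htriangle := eLpNorm_add_le ((hmeas n (hgₙ n)).sub (hmeas n hg))
    ((hmeas n hg).sub hmeas_lim) one_le_two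
  rw [sub_add_sub_cancel] at htriangle
  refine htriangle.trans (add_le_add_left ?_ _)
  exact eLpNorm_le_mul_eLpNorm_of_ae_le_mul
    (ae_of_all _ fun a => norm_testGradient_sub_le hf hZ _ _ _ _) 2

end AdmissibleTestFunction

section WeakDivergence

lemma eventually_closedBall_bump_subset {V : Type*} [NormedAddCommGroup V] [NormedSpace ℝ V]
    {K : Set V} {ζ : V → ℝ} (hζ : IsTestFunction (interior K) ζ) :
    ∀ᶠ n in atTop, ∀ x ∈ tsupport ζ, Metric.closedBall x (bump V n).rOut ⊆ K := by
  obtain ⟨δ, hδ, hδK⟩ := hζ.hasCompactSupport.isCompact.exists_cthickening_subset_open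
    isOpen_interior hζ.tsupport_subset
  filter_upwards [(tendsto_bump_rOut V).eventually (ge_mem_nhds hδ)] with n hn x hx
  exact (Metric.closedBall_subset_closedBall hn).trans <|
    (Metric.closedBall_subset_cthickening hx δ).trans (hδK.trans interior_subset)

variable {V : Type*} [NormedAddCommGroup V] [InnerProductSpace ℝ V] [FiniteDimensional ℝ V]
  [MeasurableSpace V] [BorelSpace V] {K : Set V} {v w ζ : V → ℝ} {P g : V → V}

/-- `v = div P` weakly on `K`, tested with functions supported in `K`. -/
def IsWeakDivergenceOn (K : Set V) (v : V → ℝ) (P : V → V) : Prop :=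
  ∀ φ, IsTestFunction K φ → (∫ x, v x * φ x) + ∫ x, inner ℝ (P x) (gradient φ x) = 0

lemma IsWeakDivergenceOn.add_eq_zero_of_tendsto (hvP : IsWeakDivergenceOn K v P)
    (hv : MemLp v 2 volume) (hP : MemLp P 2 volume) {φₙ : ℕ → V → ℝ} {φ : V → ℝ} {Φ : V → V}
    (hφₙ : ∀ n, IsTestFunction K (φₙ n)) (hφ : MemLp φ 2 volume) (hΦ : MemLp Φ 2 volume)
    (hlim : Tendsto (fun n => eLpNorm (φₙ n - φ) 2 volume) atTop (𝓝 0))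
    (hlim_grad : Tendsto (fun n => eLpNorm (gradient (φₙ n) - Φ) 2 volume) atTop (𝓝 0)) :
    (∫ x, v x * φ x) + ∫ x, inner ℝ (P x) (Φ x) = 0 := by
  have hv0 : Tendsto (fun _ : ℕ => eLpNorm (v - v) 2 volume) atTop (𝓝 0) := by simp
  have hP0 : Tendsto (fun _ : ℕ => eLpNorm (P - P) 2 volume) atTop (𝓝 0) := by simp
  have hlim_v := tendsto_integral_inner (fun n => (hφₙ n).memLp) hφ (fun _ => hv) hv hlim hv0
  have hlim_P := tendsto_integral_inner (fun _ => hP) hP (fun n => (hφₙ n).memLp_gradient) hΦ hP0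
    hlim_grad
  exact tendsto_nhds_unique ((hlim_v.add hlim_P).congr fun n => hvP _ (hφₙ n)) tendsto_const_nhds

lemma IsWeakGradientOn.eventually_gradient_comp_moll (hwg : IsWeakGradientOn K w g)
    (hw : LocallyIntegrable w volume) {f : ℝ → ℝ} (hf : ContDiff ℝ ∞ f)
    (hζ : IsTestFunction (interior K) ζ) :
    ∀ᶠ n in atTop, gradient (fun x => f (moll n w x) * ζ x) =
      fun x => testGradient f ζ (moll n w x) (moll n g x) x := by
  filter_upwards [eventually_closedBall_bump_subset hζ] with n hn
  funext x
  rw [gradient_comp_mul (hf.differentiable (by simp))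
    ((contDiff_moll hw n).differentiable (by simp)).differentiableAt
    hζ.differentiable.differentiableAt, testGradient]
  by_cases hx : x ∈ tsupport ζ
  · rw [hwg.gradient_moll hw (hn x hx)]
  · simp [image_eq_zero_of_notMem_tsupport hx]

lemma IsWeakDivergenceOn.integral_comp_mul (hvP : IsWeakDivergenceOn K v P)
    (hwg : IsWeakGradientOn K w g) (hv : MemLp v 2 volume) (hP : MemLp P 2 volume)
    (hw : MemLp w 2 volume) (hg : MemLp g 2 volume) {f : ℝ → ℝ} {c c' : ℝ}
    (hf : SmoothBounded f c c') (hζ : IsTestFunction (interior K) ζ) :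
    (∫ x, v x * (f (w x) * ζ x)) + ∫ x, inner ℝ (P x) (testGradient f ζ (w x) (g x) x) = 0 := by
  have hwl : LocallyIntegrable w volume := hw.locallyIntegrable one_le_two
  have hmoll n : ContDiff ℝ ∞ (moll n w) := contDiff_moll hwl n
  have hlimw := ae_tendsto_moll hwl
  refine hvP.add_eq_zero_of_tendsto hv hP (φₙ := fun n x => f (moll n w x) * ζ x)
    (fun n => (hζ.mono interior_subset).mul_left (hf.contDiff.comp (hmoll n)))
    (hf.memLp_comp_mul hw.1 hζ.memLp)
    (memLp_testGradient hf hζ hw.1 hg aestronglyMeasurable_id hζ.memLp_gradient) ?_ ?_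
  · refine tendsto_eLpNorm_two_sub_of_dominated
      (fun n => (hf.memLp_comp_mul (memLp_moll hw n).1 (hζ.memLp (p := 2))).1)
      (hf.memLp_comp_mul hw.1 (hζ.memLp (p := 2))).1 (hζ.memLp.norm.const_mul c)
      (fun n => ae_of_all _ fun x => ?_) ?_
    · rw [norm_mul]
      gcongr
      exact hf.abs_le _
    · filter_upwards [hlimw] with x hx
      exact ((hf.contDiff.continuous.tendsto _).comp hx).mul_const _
  · refine (tendsto_eLpNorm_testGradient_sub hf hζ (fun n => (memLp_moll hw n).1) hw.1
      (memLp_moll hg) hg aestronglyMeasurable_id hζ.memLp_gradient hlimw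
      (tendsto_eLpNorm_moll_sub hg)).congr' ?_
    filter_upwards [hwg.eventually_gradient_comp_moll hwl hf.contDiff hζ] with n hn
    rw [hn]
    rfl

end WeakDivergence

section LogPrimitive

/-- The primitive of `f ∘ log` that vanishes at `0`; its composition with `u` is the conserved
quantity dual to the test function `f(log u)`. -/
noncomputable def logPrimitive (f : ℝ → ℝ) (a : ℝ) : ℝ := ∫ v in (0 : ℝ)..a, f (Real.log v)

variable {f : ℝ → ℝ} {c : ℝ}

lemma intervalIntegrable_comp_log (hf : Continuous f) (hfc : ∀ a, |f a| ≤ c) (a b : ℝ) :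
    IntervalIntegrable (fun v => f (Real.log v)) volume a b := by
  refine (intervalIntegrable_const (c := c)).mono_fun
    (hf.measurable.comp Real.measurable_log).aestronglyMeasurable (ae_of_all _ fun v => ?_)
  exact (hfc _).trans (le_abs_self c)

lemma abs_logPrimitive_le (hfc : ∀ a, |f a| ≤ c) (a : ℝ) : |logPrimitive f a| ≤ c * |a| := by
  have hbound := intervalIntegral.norm_integral_le_of_norm_le_const (a := 0) (b := a)
    (f := fun v => f (Real.log v)) (C := c) fun v _ => hfc _
  simpa [logPrimitive] using hbound

lemma continuous_logPrimitive (hf : Continuous f) (hfc : ∀ a, |f a| ≤ c) :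
    Continuous (logPrimitive f) :=
  intervalIntegral.continuous_primitive (fun a b => intervalIntegrable_comp_log hf hfc a b) 0

lemma logPrimitive_sub_le (hf : Continuous f) (hfc : ∀ a, |f a| ≤ c) (hmono : Monotone f)
    {a b : ℝ} (ha : 0 < a) (hb : 0 < b) :
    logPrimitive f a - logPrimitive f b ≤ (a - b) * f (Real.log a) := by
  have hi := intervalIntegrable_comp_log hf hfc
  have hconst {x y : ℝ} := intervalIntegrable_const (a := x) (b := y) (μ := volume)
    (c := f (Real.log a))
  rw [logPrimitive, logPrimitive, intervalIntegral.integral_interval_sub_left (hi _ _) (hi _ _)]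
  rcases le_total b a with h | h
  · simpa using intervalIntegral.integral_mono_on h (hi b a) hconst
      fun v hv => hmono (Real.log_le_log (hb.trans_le hv.1) hv.2)
  · have hle := intervalIntegral.integral_mono_on h hconst (hi a b)
      fun v hv => hmono (Real.log_le_log ha hv.1)
    rw [intervalIntegral.integral_symm]
    simp only [intervalIntegral.integral_const, smul_eq_mul] at hle
    linarith

variable {α : Type*} [MeasurableSpace α] {μ : Measure α} {u u₁ u₂ w ζ : α → ℝ}

lemma memLp_logPrimitive_comp {p : ℝ≥0∞} (hf : Continuous f) (hfc : ∀ a, |f a| ≤ c)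
    (hu : MemLp u p μ) : MemLp (fun x => logPrimitive f (u x)) p μ :=
  hu.of_le_mul ((continuous_logPrimitive hf hfc).comp_aestronglyMeasurable hu.1)
    (ae_of_all _ fun _ => abs_logPrimitive_le hfc _)

lemma abs_integral_logPrimitive_mul_le (hfc : ∀ a, |f a| ≤ c) (hζ : ∀ x, 0 ≤ ζ x)
    (hu : ∀ᵐ x ∂μ, ζ x ≠ 0 → 0 ≤ u x) (hi : Integrable (fun x => u x * ζ x) μ) :
    |∫ x, logPrimitive f (u x) * ζ x ∂μ| ≤ c * ∫ x, u x * ζ x ∂μ := by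
  rw [← integral_const_mul, ← Real.norm_eq_abs]
  refine norm_integral_le_of_norm_le (hi.const_mul c) ?_
  filter_upwards [hu] with x hx
  by_cases hζx : ζ x = 0
  · simp [hζx]
  · have hle := abs_logPrimitive_le hfc (u x)
    rw [abs_of_nonneg (hx hζx)] at hle
    rw [norm_mul, Real.norm_of_nonneg (hζ x), ← mul_assoc]
    exact mul_le_mul_of_nonneg_right hle (hζ x)

lemma integral_logPrimitive_mul_sub_le {c' : ℝ} (hf : SmoothBounded f c c') (hmono : Monotone f)
    (hζ : ∀ x, 0 ≤ ζ x) (hζ2 : MemLp ζ 2 μ) (hu₁ : MemLp u₁ 2 μ) (hu₂ : MemLp u₂ 2 μ)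
    (hw : AEStronglyMeasurable w μ)
    (hpos₁ : ∀ᵐ x ∂μ, ζ x ≠ 0 → 0 < u₁ x ∧ w x = Real.log (u₁ x))
    (hpos₂ : ∀ᵐ x ∂μ, ζ x ≠ 0 → 0 < u₂ x) :
    (∫ x, logPrimitive f (u₁ x) * ζ x ∂μ) - ∫ x, logPrimitive f (u₂ x) * ζ x ∂μ ≤
      ∫ x, (u₁ x - u₂ x) * (f (w x) * ζ x) ∂μ := by
  have hfc := hf.contDiff.continuous
  have hi₁ : Integrable (fun x => logPrimitive f (u₁ x) * ζ x) μ :=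
    (memLp_logPrimitive_comp hfc hf.abs_le hu₁).integrable_mul hζ2
  have hi₂ : Integrable (fun x => logPrimitive f (u₂ x) * ζ x) μ :=
    (memLp_logPrimitive_comp hfc hf.abs_le hu₂).integrable_mul hζ2
  rw [← integral_sub hi₁ hi₂]
  refine integral_mono_ae (hi₁.sub hi₂)
    ((hu₁.sub hu₂).integrable_mul (hf.memLp_comp_mul hw hζ2)) ?_
  filter_upwards [hpos₁, hpos₂] with x h₁ h₂
  by_cases hζx : ζ x = 0
  · simp [hζx]
  · have hle := logPrimitive_sub_le hfc hf.abs_le hmono (h₁ hζx).1 (h₂ hζx)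
    rw [← (h₁ hζx).2] at hle
    nlinarith [hζ x]

end LogPrimitive

section Shift

lemma ae_restrict_Ioc_shift {p : ℝ → Prop} {s t : ℝ} (h : ℝ)
    (hp : ∀ᵐ τ ∂(volume.restrict (Ioc s t)), p τ) (hh : 0 ≤ h) :
    ∀ᵐ τ ∂(volume.restrict (Ioc (s + h) t)), p (τ - h) := by
  rw [ae_restrict_iff' measurableSet_Ioc] at hp ⊢
  filter_upwards [(measurePreserving_sub_right volume h).quasiMeasurePreserving.ae hp] with τ hτ hm
  exact hτ ⟨by linarith [hm.1], by linarith [hm.2]⟩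

variable {m : ℝ → ℝ} {s t h B : ℝ}

lemma intervalIntegrable_shift_sub (hh : 0 ≤ h) (hht : s + h ≤ t)
    (hm : IntervalIntegrable m volume s t) :
    IntervalIntegrable (fun τ => m (τ - h)) volume (s + h) t ∧
      IntervalIntegrable m volume (s + h) t := by
  have hst : s ≤ t := by linarith
  refine ⟨?_, hm.mono_set ?_⟩
  · have hshift := (hm.mono_set (c := s) (d := t - h) ?_).comp_sub_right h
    · simpa using hshift
    · rw [uIcc_of_le (by linarith), uIcc_of_le hst]
      exact Icc_subset_Icc_right (by linarith)
  · rw [uIcc_of_le hht, uIcc_of_le hst]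
    exact Icc_subset_Icc_left (by linarith)

lemma integral_shift_sub_le (hh : 0 ≤ h) (hht : s + h ≤ t) (hm : IntervalIntegrable m volume s t)
    (hB : ∀ᵐ τ ∂(volume.restrict (Ioc s t)), |m τ| ≤ B) :
    ∫ τ in (s + h)..t, (m (τ - h) - m τ) ≤ 2 * B * h := by
  have hst : s ≤ t := by linarith
  have hsub {a b : ℝ} (ha : s ≤ a) (hab : a ≤ b) (hb : b ≤ t) : IntervalIntegrable m volume a b :=
    hm.mono_set <| by
      rw [uIcc_of_le hab, uIcc_of_le hst]
      exact Icc_subset_Icc ha hb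
  have hbound {a b : ℝ} (ha : s ≤ a) (hab : a ≤ b) (hb : b ≤ t) :
      |∫ τ in a..b, m τ| ≤ B * (b - a) := by
    rw [← abs_of_nonneg (sub_nonneg.2 hab), ← Real.norm_eq_abs (∫ τ in a..b, m τ)]
    refine intervalIntegral.norm_integral_le_of_norm_le_const_ae ?_
    rw [uIoc_of_le hab]
    filter_upwards [(ae_restrict_iff' measurableSet_Ioc).1 hB] with τ hτ hmem
    exact hτ (Ioc_subset_Ioc ha hb hmem)
  obtain ⟨hshift, hrest⟩ := intervalIntegrable_shift_sub hh hht hm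
  calc ∫ τ in (s + h)..t, (m (τ - h) - m τ)
      = (∫ τ in s..(s + h), m τ) - ∫ τ in (t - h)..t, m τ := by
        rw [intervalIntegral.integral_sub hshift hrest,
          intervalIntegral.integral_comp_sub_right m h, add_sub_cancel_right]
        have hleft := intervalIntegral.integral_add_adjacent_intervals
          (hsub le_rfl (by linarith) hht) hrest
        have hright := intervalIntegral.integral_add_adjacent_intervals
          (hsub le_rfl (b := t - h) (by linarith) (by linarith))
          (hsub (by linarith) (by linarith) le_rfl)
        linarith
    _ ≤ 2 * B * h := by
        have hfirst := (abs_le.1 (hbound le_rfl (b := s + h) (by linarith) hht)).2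
        have hlast := (abs_le.1 (hbound (a := t - h) (by linarith) (by linarith) le_rfl)).1
        linarith

end Shift

section Slab

variable {α F : Type*} [MeasurableSpace α] {μ : Measure α} [SFinite μ] [NormedAddCommGroup F]

lemma prod_restrict_eq_restrict_univ_prod (A : Set ℝ) :
    μ.prod (volume.restrict A) = (μ.prod volume).restrict (univ ×ˢ A) := by
  rw [← Measure.prod_restrict, Measure.restrict_univ]

lemma memLp_slab {g : α × ℝ → F} {p : ℝ≥0∞} (hg : MemLp g p (μ.prod volume)) (A : Set ℝ) :
    MemLp g p (μ.prod (volume.restrict A)) := by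
  rw [prod_restrict_eq_restrict_univ_prod]
  exact hg.restrict _

lemma ae_slice_of_ae_prod {A : Set ℝ} {p : α × ℝ → Prop}
    (h : ∀ᵐ z ∂(μ.prod (volume.restrict A)), p z) :
    ∀ᵐ τ ∂(volume.restrict A), ∀ᵐ x ∂μ, p (x, τ) :=
  Measure.ae_ae_of_ae_prod (Measure.measurePreserving_swap.quasiMeasurePreserving.ae h)

lemma tendsto_eLpNorm_indicator_Ioc_sub {g : α × ℝ → F} {s t : ℝ} {h : ℕ → ℝ}
    (hg : MemLp g 2 (μ.prod (volume.restrict (Ioc s t)))) (hh : Tendsto h atTop (𝓝 0)) :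
    Tendsto (fun n => eLpNorm ((univ ×ˢ Ioc (s + h n) t).indicator g - g) 2
      (μ.prod (volume.restrict (Ioc s t)))) atTop (𝓝 0) := by
  refine tendsto_eLpNorm_two_sub_of_dominated
    (fun n => hg.1.indicator (MeasurableSet.univ.prod measurableSet_Ioc)) hg.1 hg.norm
    (fun n => ae_of_all _ fun z => norm_indicator_le_norm_self _ _) ?_
  rw [prod_restrict_eq_restrict_univ_prod]
  filter_upwards [ae_restrict_mem (MeasurableSet.univ.prod measurableSet_Ioc)] with z hz
  refine tendsto_const_nhds.congr' ?_
  filter_upwards [hh.eventually (gt_mem_nhds (sub_pos.2 hz.2.1))] with n hn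
  have hmem : z ∈ (univ : Set α) ×ˢ Ioc (s + h n) t := ⟨mem_univ _, by linarith, hz.2.2⟩
  exact (indicator_of_mem hmem g).symm

end Slab

section Steklov

variable {V : Type*} [NormedAddCommGroup V] [MeasurableSpace V] {h : ℝ}

/-- The backward Steklov average of `F` in the time variable, over a time step `h`. -/
noncomputable def steklov [NormedSpace ℝ V] (h : ℝ) (F : V × ℝ → V) (z : V × ℝ) : V :=
  h⁻¹ • ∫ σ in z.2 - h..z.2, F (z.1, σ)

variable (V) in
/-- The uniform distribution of a purely temporal shift by at most `h`; averaging over it is the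
Steklov average. -/
noncomputable def timeShift (h : ℝ) : Measure (V × ℝ) :=
  ((ENNReal.ofReal h)⁻¹ • volume.restrict (Ioc 0 h)).map (Prod.mk 0)

lemma isProbabilityMeasure_timeShift (hh : 0 < h) : IsProbabilityMeasure (timeShift V h) := by
  have hprob : IsProbabilityMeasure ((ENNReal.ofReal h)⁻¹ • volume.restrict (Ioc 0 h)) := by
    refine ⟨?_⟩
    rw [Measure.smul_apply, Measure.restrict_apply_univ, Real.volume_Ioc, sub_zero, smul_eq_mul]
    exact ENNReal.inv_mul_cancel (by simpa using hh) ENNReal.ofReal_ne_top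
  exact Measure.isProbabilityMeasure_map measurable_prodMk_left.aemeasurable

lemma ae_timeShift_norm_le [OpensMeasurableSpace V] (h : ℝ) :
    ∀ᵐ v ∂timeShift V h, ‖v‖ ≤ h := by
  simp only [timeShift, Prod.norm_def]
  rw [ae_map_iff measurable_prodMk_left.aemeasurable
    (measurableSet_le (measurable_fst.norm.max measurable_snd.norm) measurable_const)]
  refine Measure.ae_smul_measure ?_ _
  filter_upwards [ae_restrict_mem measurableSet_Ioc] with θ hθ
  rw [norm_zero, Real.norm_of_nonneg hθ.1.le]
  exact max_le (hθ.1.le.trans hθ.2) hθ.2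

variable [NormedSpace ℝ V]

lemma steklov_eq_average [MeasurableSingletonClass V] (hh : 0 < h) (F : V × ℝ → V) :
    steklov h F = fun z => ∫ v, F (z - v) ∂timeShift V h := by
  funext z
  rw [steklov, timeShift, (measurableEmbedding_prodMk_left (0 : V)).integral_map,
    integral_smul_measure, ENNReal.toReal_inv, ENNReal.toReal_ofReal hh.le,
    ← intervalIntegral.integral_of_le hh.le]
  have hreflect := intervalIntegral.integral_comp_sub_left (a := 0) (b := h)
    (fun σ => F (z.1, σ)) z.2
  rw [sub_zero] at hreflect
  simp only [← hreflect, Prod.sub_def, sub_zero]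

variable [FiniteDimensional ℝ V] [BorelSpace V] {μ : Measure V} [μ.IsAddHaarMeasure]
  {F : V × ℝ → V}

lemma memLp_steklov (hh : 0 < h) (hF : MemLp F 2 (μ.prod volume)) :
    MemLp (steklov h F) 2 (μ.prod volume) := by
  have := isProbabilityMeasure_timeShift (V := V) hh
  rw [steklov_eq_average hh]
  exact memLp_average hF

lemma tendsto_eLpNorm_steklov_sub (hF : MemLp F 2 (μ.prod volume)) {hₙ : ℕ → ℝ}
    (hpos : ∀ n, 0 < hₙ n) (hlim : Tendsto hₙ atTop (𝓝 0)) :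
    Tendsto (fun n => eLpNorm (steklov (hₙ n) F - F) 2 (μ.prod volume)) atTop (𝓝 0) := by
  have := fun n => isProbabilityMeasure_timeShift (V := V) (hpos n)
  simp only [steklov_eq_average (hpos _)]
  exact tendsto_eLpNorm_average_sub hF hlim fun n => ae_timeShift_norm_le (hₙ n)

end Steklov

section Energy

variable {V : Type*} [NormedAddCommGroup V] [InnerProductSpace ℝ V] [FiniteDimensional ℝ V]
  [MeasurableSpace V] [BorelSpace V]

/-- `u_t = div F` weakly on `K`, over the time interval `[s, t]`, where `u > 0` and `w = log u` has
the weak gradient `G`. The functions are defined and square integrable on the whole space-time: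
local data are cut off outside the cylinder `K × (s, t]`. -/
structure LogWeakSolutionOn (K : Set V) (s t : ℝ) (u w : V × ℝ → ℝ) (F G : V × ℝ → V) : Prop where
  memLp_u : MemLp u 2 (volume.prod volume)
  memLp_w : MemLp w 2 (volume.prod volume)
  memLp_F : MemLp F 2 (volume.prod volume)
  memLp_G : MemLp G 2 (volume.prod volume)
  isWeakGradientOn : ∀ᵐ τ ∂(volume.restrict (Ioc s t)),
    IsWeakGradientOn K (fun x => w (x, τ)) (fun x => G (x, τ))
  equation : ∀ φ, IsTestFunction K φ → ∀ t₁ t₂ : ℝ, s ≤ t₁ → t₁ < t₂ → t₂ ≤ t →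
    (∫ x, u (x, t₂) * φ x) - (∫ x, u (x, t₁) * φ x) +
      ∫ z, inner ℝ (F z) (gradient φ z.1) ∂(volume.prod (volume.restrict (Ioc t₁ t₂))) = 0
  pos : ∀ᵐ z ∂((volume.restrict K).prod (volume.restrict (Ioc s t))),
    0 < u z ∧ w z = Real.log (u z)

/-- The entropy `∫ Ψ(u) ζ` at time `τ`, where `Ψ' = f ∘ log`; its time derivative is the flux of
`u` tested with `f(log u) ζ`. -/
noncomputable def logEntropy (f : ℝ → ℝ) (ζ : V → ℝ) (u : V × ℝ → ℝ) (τ : ℝ) : ℝ :=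
  ∫ x, logPrimitive f (u (x, τ)) * ζ x

namespace LogWeakSolutionOn

variable {K : Set V} {s t : ℝ} {u w : V × ℝ → ℝ} {F G : V × ℝ → V} {f : ℝ → ℝ} {c c' S h : ℝ}
  {ζ : V → ℝ}

lemma isWeakDivergenceOn (D : LogWeakSolutionOn K s t u w F G) {t₁ t₂ : ℝ} (h₁ : s ≤ t₁)
    (h₁₂ : t₁ < t₂) (h₂ : t₂ ≤ t) (hu₁ : MemLp (fun x => u (x, t₁)) 2 volume)
    (hu₂ : MemLp (fun x => u (x, t₂)) 2 volume) :
    IsWeakDivergenceOn K (fun x => u (x, t₂) - u (x, t₁)) (fun x => ∫ σ in t₁..t₂, F (x, σ)) := by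
  intro φ hφ
  have hF := memLp_slab D.memLp_F (Ioc t₁ t₂)
  rw [← D.equation φ hφ t₁ t₂ h₁ h₁₂ h₂]
  congr 1
  · simp only [sub_mul]
    exact integral_sub (hu₂.integrable_mul (hφ.memLp (p := 2)))
      (hu₁.integrable_mul (hφ.memLp (p := 2)))
  · rw [integral_prod _ (integrable_inner_of_memLp hF (hφ.memLp_gradient.comp_fst _))]
    refine integral_congr_ae ?_
    filter_upwards [ae_memLp_two_prodMk_left hF] with x hx
    have hFx : Integrable (fun σ => F (x, σ)) (volume.restrict (Ioc t₁ t₂)) :=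
      hx.integrable one_le_two
    simp only [intervalIntegral.integral_of_le h₁₂.le, real_inner_comm (gradient φ x)]
    exact (integral_inner hFx (gradient φ x)).symm

lemma ae_slice_pos (D : LogWeakSolutionOn K s t u w F G) (hζ : IsTestFunction (interior K) ζ) :
    ∀ᵐ τ ∂(volume.restrict (Ioc s t)), ∀ᵐ x,
      ζ x ≠ 0 → 0 < u (x, τ) ∧ w (x, τ) = Real.log (u (x, τ)) := by
  filter_upwards [ae_slice_of_ae_prod D.pos] with τ hτ
  have hint := ae_restrict_of_ae_restrict_of_subset interior_subset hτ
  filter_upwards [(ae_restrict_iff' isOpen_interior.measurableSet).1 hint] with x hx hζx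
  exact hx (by_contra fun hmem => hζx (hζ.eq_zero_of_notMem hmem))

lemma ae_abs_logEntropy_le (D : LogWeakSolutionOn K s t u w F G) (hf : SmoothBounded f c c')
    (hζ : IsTestFunction (interior K) ζ) (hζ0 : ∀ x, 0 ≤ ζ x)
    (hS : ∀ᵐ τ ∂(volume.restrict (Ioc s t)), ∫ x, u (x, τ) * ζ x ≤ S) :
    ∀ᵐ τ ∂(volume.restrict (Ioc s t)), |logEntropy f ζ u τ| ≤ c * S := by
  filter_upwards [D.ae_slice_pos hζ, hS, ae_restrict_of_ae (ae_memLp_two_prodMk_right D.memLp_u)]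
    with τ hpos hτ hu
  exact (abs_integral_logPrimitive_mul_le hf.abs_le hζ0 (hpos.mono fun x hx h => (hx h).1.le)
    (hu.integrable_mul (hζ.memLp (p := 2)))).trans (mul_le_mul_of_nonneg_left hτ hf.nonneg)

lemma intervalIntegrable_logEntropy (D : LogWeakSolutionOn K s t u w F G)
    (hf : SmoothBounded f c c') (hζ : IsTestFunction K ζ) (a b : ℝ) :
    IntervalIntegrable (logEntropy f ζ u) volume a b := by
  rw [intervalIntegrable_iff, uIoc]
  have hΨ := memLp_logPrimitive_comp hf.contDiff.continuous hf.abs_le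
    (memLp_slab D.memLp_u (Ioc (min a b) (max a b)))
  exact Integrable.integral_prod_right (f := fun z : V × ℝ => logPrimitive f (u z) * ζ z.1)
    (hΨ.integrable_mul ((hζ.memLp (p := 2)).comp_fst _))

lemma memLp_testGradient_slab (D : LogWeakSolutionOn K s t u w F G) (hf : SmoothBounded f c c')
    {L : Set V} (hζ : IsTestFunction L ζ) (a b : ℝ) :
    MemLp (fun z => testGradient f ζ (w z) (G z) z.1) 2
      (volume.prod (volume.restrict (Ioc a b))) :=
  memLp_testGradient hf hζ (memLp_slab D.memLp_w _).1 (memLp_slab D.memLp_G _)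
    measurable_fst.aestronglyMeasurable (hζ.memLp_gradient.comp_fst _)

lemma ae_integral_inner_le_logEntropy_sub (D : LogWeakSolutionOn K s t u w F G)
    (hf : SmoothBounded f c c') (hmono : Monotone f) (hζ : IsTestFunction (interior K) ζ)
    (hζ0 : ∀ x, 0 ≤ ζ x) (hh : 0 < h) :
    ∀ᵐ τ ∂(volume.restrict (Ioc (s + h) t)),
      ∫ x, inner ℝ (steklov h F (x, τ)) (testGradient f ζ (w (x, τ)) (G (x, τ)) x) ≤
        h⁻¹ * (logEntropy f ζ u (τ - h) - logEntropy f ζ u τ) := by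
  have hsub : Ioc (s + h) t ⊆ Ioc s t := Ioc_subset_Ioc_left (by linarith)
  have hu : ∀ᵐ τ ∂(volume.restrict (Ioc s t)), MemLp (fun x => u (x, τ)) 2 volume :=
    ae_restrict_of_ae (ae_memLp_two_prodMk_right D.memLp_u)
  filter_upwards [ae_restrict_of_ae_restrict_of_subset hsub (D.ae_slice_pos hζ),
    ae_restrict_Ioc_shift h (D.ae_slice_pos hζ) hh.le,
    ae_restrict_of_ae_restrict_of_subset hsub hu, ae_restrict_Ioc_shift h hu hh.le,
    ae_restrict_of_ae_restrict_of_subset hsub D.isWeakGradientOn,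
    ae_restrict_of_ae (ae_memLp_two_prodMk_right D.memLp_w),
    ae_restrict_of_ae (ae_memLp_two_prodMk_right D.memLp_G),
    ae_restrict_of_ae (ae_memLp_two_prodMk_right (memLp_steklov hh D.memLp_F)),
    ae_restrict_mem measurableSet_Ioc] with τ hpos hpos_shift hu hu_shift hgrad hw hG hF hτ
  have hP : MemLp (fun x => ∫ σ in τ - h..τ, F (x, σ)) 2 volume :=
    (hF.const_smul h).ae_eq (ae_of_all _ fun x => by simp [steklov, hh.ne'])
  have htested := (D.isWeakDivergenceOn (by linarith [hτ.1]) (by linarith) hτ.2 hu_shift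
    hu).integral_comp_mul hgrad (hu.sub hu_shift) hP hw hG hf hζ
  have hconvex := integral_logPrimitive_mul_sub_le hf hmono hζ0 hζ.memLp hu hu_shift hw.1 hpos
    (hpos_shift.mono fun x hx h => (hx h).1)
  simp only [steklov, real_inner_smul_left, integral_const_mul]
  refine mul_le_mul_of_nonneg_left ?_ (inv_nonneg.2 hh.le)
  rw [logEntropy, logEntropy]
  linarith

lemma steklov_energy_le (D : LogWeakSolutionOn K s t u w F G) (hf : SmoothBounded f c c')
    (hmono : Monotone f) (hζ : IsTestFunction (interior K) ζ) (hζ0 : ∀ x, 0 ≤ ζ x)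
    (hS : ∀ᵐ τ ∂(volume.restrict (Ioc s t)), ∫ x, u (x, τ) * ζ x ≤ S)
    (hh : 0 < h) (hht : s + h ≤ t) :
    ∫ z, inner ℝ (steklov h F z) (testGradient f ζ (w z) (G z) z.1)
      ∂(volume.prod (volume.restrict (Ioc (s + h) t))) ≤ 2 * (c * S) := by
  have hint := integrable_inner_of_memLp (memLp_slab (memLp_steklov hh D.memLp_F) _)
    (D.memLp_testGradient_slab hf hζ (s + h) t)
  have hentropy := D.intervalIntegrable_logEntropy hf (hζ.mono interior_subset) s t
  obtain ⟨hshift, hrest⟩ := intervalIntegrable_shift_sub hh.le hht hentropy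
  rw [integral_prod_symm _ hint]
  calc ∫ τ in Ioc (s + h) t,
        ∫ x, inner ℝ (steklov h F (x, τ)) (testGradient f ζ (w (x, τ)) (G (x, τ)) x)
      ≤ ∫ τ in Ioc (s + h) t, h⁻¹ * (logEntropy f ζ u (τ - h) - logEntropy f ζ u τ) :=
        integral_mono_ae hint.integral_prod_right
          (((intervalIntegrable_iff_integrableOn_Ioc_of_le hht).1 (hshift.sub hrest)).const_mul _)
          (D.ae_integral_inner_le_logEntropy_sub hf hmono hζ hζ0 hh)
    _ = h⁻¹ * ∫ τ in (s + h)..t, (logEntropy f ζ u (τ - h) - logEntropy f ζ u τ) := by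
        rw [integral_const_mul, intervalIntegral.integral_of_le hht]
    _ ≤ h⁻¹ * (2 * (c * S) * h) := by
        gcongr
        exact integral_shift_sub_le hh.le hht hentropy (D.ae_abs_logEntropy_le hf hζ hζ0 hS)
    _ = 2 * (c * S) := by field_simp

lemma energy_le (D : LogWeakSolutionOn K s t u w F G) (hst : s < t) (hf : SmoothBounded f c c')
    (hmono : Monotone f) (hζ : IsTestFunction (interior K) ζ) (hζ0 : ∀ x, 0 ≤ ζ x)
    (hS : ∀ᵐ τ ∂(volume.restrict (Ioc s t)), ∫ x, u (x, τ) * ζ x ≤ S) :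
    ∫ z, inner ℝ (F z) (testGradient f ζ (w z) (G z) z.1)
      ∂(volume.prod (volume.restrict (Ioc s t))) ≤ 2 * (c * S) := by
  let hₙ : ℕ → ℝ := fun n => (t - s) * (1 / ((n : ℝ) + 1))
  have hpos n : 0 < hₙ n := mul_pos (sub_pos.2 hst) (by positivity)
  have hle n : s + hₙ n ≤ t := by
    have hone : 1 / ((n : ℝ) + 1) ≤ 1 := by
      rw [div_le_one (by positivity)]
      linarith [Nat.cast_nonneg (α := ℝ) n]
    linarith [mul_le_of_le_one_right (sub_pos.2 hst).le hone]
  have hlim : Tendsto hₙ atTop (𝓝 0) := by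
    simpa only [mul_zero] using
      (tendsto_one_div_add_atTop_nhds_zero_nat (𝕜 := ℝ)).const_mul (t - s)
  have hΦ := D.memLp_testGradient_slab hf hζ s t
  have hsteklov : Tendsto (fun n => eLpNorm (steklov (hₙ n) F - F) 2
      (volume.prod (volume.restrict (Ioc s t)))) atTop (𝓝 0) := by
    refine tendsto_of_tendsto_of_tendsto_of_le_of_le tendsto_const_nhds
      (tendsto_eLpNorm_steklov_sub D.memLp_F hpos hlim) (fun _ => zero_le) fun n => ?_
    rw [prod_restrict_eq_restrict_univ_prod]
    exact eLpNorm_mono_measure _ Measure.restrict_le_self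
  refine le_of_tendsto (tendsto_integral_inner
    (fun n => memLp_slab (memLp_steklov (hpos n) D.memLp_F) _) (memLp_slab D.memLp_F _)
    (fun n => hΦ.indicator (MeasurableSet.univ.prod measurableSet_Ioc)) hΦ hsteklov
    (tendsto_eLpNorm_indicator_Ioc_sub hΦ hlim)) (Eventually.of_forall fun n => ?_)
  refine le_of_eq_of_le ?_ (D.steklov_energy_le hf hmono hζ hζ0 hS (hpos n) (hle n))
  have hrestrict : (volume : Measure V).prod (volume.restrict (Ioc (s + hₙ n) t)) =
      (volume.prod (volume.restrict (Ioc s t))).restrict (univ ×ˢ Ioc (s + hₙ n) t) := by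
    rw [← Measure.prod_restrict, Measure.restrict_univ,
      Measure.restrict_restrict measurableSet_Ioc,
      inter_eq_left.2 (Ioc_subset_Ioc_left (by linarith [hpos n]))]
  rw [hrestrict, ← integral_indicator (MeasurableSet.univ.prod measurableSet_Ioc)]
  congr 1 with z
  by_cases hz : z ∈ (univ : Set V) ×ˢ Ioc (s + hₙ n) t <;> simp [hz]

end LogWeakSolutionOn

end Energy

section EllipticFlux

lemma smoothBounded_arctan_sub (l : ℝ) : SmoothBounded (fun a => Real.arctan (a - l)) 2 1 where
  contDiff := Real.contDiff_arctan.comp (contDiff_id.sub contDiff_const)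
  abs_le a := abs_le.2 ⟨by linarith [Real.neg_pi_div_two_lt_arctan (a - l), Real.pi_le_four],
    by linarith [Real.arctan_lt_pi_div_two (a - l), Real.pi_le_four]⟩
  abs_deriv_le a := by
    have hderiv : deriv (fun a => Real.arctan (a - l)) a = 1 / (1 + (a - l) ^ 2) := by simp
    rw [hderiv, abs_of_nonneg (by positivity), div_le_one (by positivity)]
    linarith [sq_nonneg (a - l)]

lemma weighted_young {Co q : ℝ} (hCo : 0 < Co) (hq : 0 < q) (C₁ g b : ℝ) :
    24 * C₁ * (g * b) ≤ Co * (1 / q * g ^ 2) + 144 * C₁ ^ 2 / Co * (b ^ 2 * q) := by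
  have hsq : Co * (1 / q * g ^ 2) + 144 * C₁ ^ 2 / Co * (b ^ 2 * q) - 24 * C₁ * (g * b) =
      (Co * g - 12 * C₁ * b * q) ^ 2 / (Co * q) := by
    field_simp
    ring
  have hnonneg : 0 ≤ (Co * g - 12 * C₁ * b * q) ^ 2 / (Co * q) := by positivity
  linarith

variable {V : Type*} [NormedAddCommGroup V] [InnerProductSpace ℝ V]

/-- The flux `P` is coercive and of linear growth with respect to `g = D log u`. -/
structure IsEllipticFlux (Co C₁ : ℝ) (P g : V) : Prop where
  coercive : Co * ‖g‖ ^ 2 ≤ inner ℝ P g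
  growth : ‖P‖ ≤ C₁ * ‖g‖

variable [CompleteSpace V] {η : V → ℝ} {Co C₁ B : ℝ} {P g x : V}

lemma gradient_mul_self (hη : Differentiable ℝ η) (x : V) :
    gradient (fun x => η x * η x) x = (2 * η x) • gradient η x := by
  have hprod := gradient_comp_mul (f := id) (w := η) (ζ := η) (x := x) differentiable_id (hη x)
    (hη x)
  simp only [id, deriv_id, one_mul] at hprod
  rw [hprod, ← add_smul, two_mul]

namespace IsEllipticFlux

lemma abs_inner_gradient_mul_self_le (hP : IsEllipticFlux Co C₁ P g) (hη : Differentiable ℝ η)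
    (hη0 : 0 ≤ η x) :
    |inner ℝ P (gradient (fun x => η x * η x) x)| ≤
      2 * C₁ * (‖g‖ * (η x * ‖gradient η x‖)) := by
  rw [gradient_mul_self hη, real_inner_smul_right, abs_mul, abs_of_nonneg (by positivity)]
  calc 2 * η x * |inner ℝ P (gradient η x)|
      ≤ 2 * η x * (‖P‖ * ‖gradient η x‖) := by
        gcongr
        exact abs_real_inner_le_norm _ _
    _ ≤ 2 * η x * (C₁ * ‖g‖ * ‖gradient η x‖) := by
        gcongr
        exact hP.growth
    _ = 2 * C₁ * (‖g‖ * (η x * ‖gradient η x‖)) := by ring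

-- The derivative of `arctan` in the test function turns coercivity into a bound for
-- `η² ‖g‖² / (1 + (a - l)²)`, and Young's inequality with weight `1 + (a - l)²` absorbs the rest.
lemma mul_le_inner_testGradient_arctan (hP : IsEllipticFlux Co C₁ P g) (hCo : 0 < Co)
    (hη : Differentiable ℝ η) (hη0 : 0 ≤ η x) (hB : ‖gradient η x‖ ≤ B) (l a : ℝ) :
    20 * C₁ * (‖g‖ * (η x * ‖gradient η x‖)) ≤
      inner ℝ P (testGradient (fun a => Real.arctan (a - l)) (fun x => η x * η x) a g x) +
        144 * C₁ ^ 2 / Co * B ^ 2 * (1 + (a - l) ^ 2) := by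
  have hweight : 0 < 1 + (a - l) ^ 2 := by positivity
  have hinner : inner ℝ P (testGradient (fun a => Real.arctan (a - l)) (fun x => η x * η x) a g x) =
      1 / (1 + (a - l) ^ 2) * η x ^ 2 * inner ℝ P g +
        Real.arctan (a - l) * inner ℝ P (gradient (fun x => η x * η x) x) := by
    rw [testGradient, inner_add_right, real_inner_smul_right, real_inner_smul_right]
    simp [sq]
  have hcoercive := mul_le_mul_of_nonneg_left hP.coercive
    (show 0 ≤ 1 / (1 + (a - l) ^ 2) * η x ^ 2 by positivity)
  have hcross : |Real.arctan (a - l) * inner ℝ P (gradient (fun x => η x * η x) x)| ≤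
      2 * (2 * C₁ * (‖g‖ * (η x * ‖gradient η x‖))) := by
    rw [abs_mul]
    exact mul_le_mul ((smoothBounded_arctan_sub l).abs_le a)
      (hP.abs_inner_gradient_mul_self_le hη hη0) (abs_nonneg _) zero_le_two
  have hyoung := weighted_young hCo hweight C₁ (‖g‖ * η x) ‖gradient η x‖
  have hB2 : 144 * C₁ ^ 2 / Co * (‖gradient η x‖ ^ 2 * (1 + (a - l) ^ 2)) ≤
      144 * C₁ ^ 2 / Co * (B ^ 2 * (1 + (a - l) ^ 2)) := by gcongr
  rw [hinner]
  linarith [(abs_le.1 hcross).1]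

end IsEllipticFlux

end EllipticFlux

section WeightedMass

variable {V : Type*} [NormedAddCommGroup V] [InnerProductSpace ℝ V] [FiniteDimensional ℝ V]
  [MeasurableSpace V] [BorelSpace V]

/-- The volume of the space-time cylinder `K × (s, t]`. -/
noncomputable abbrev cylinderMeasure (K : Set V) (s t : ℝ) : Measure (V × ℝ) :=
  (volume.restrict K).prod (volume.restrict (Ioc s t))

/-- `∬ ‖G‖ η ‖Dη‖` over the cylinder `K × (s, t]`, which controls the change of the mass of `u`
weighted by `η²`. -/
noncomputable def fluxIntegral (K : Set V) (s t : ℝ) (η : V → ℝ) (G : V × ℝ → V) : ℝ :=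
  ∫ z, ‖G z‖ * (η z.1 * ‖gradient η z.1‖) ∂(cylinderMeasure K s t)

variable {K : Set V} {s t : ℝ}

lemma cylinderMeasure_eq_restrict (K : Set V) (s t : ℝ) :
    cylinderMeasure K s t = (volume.prod (volume.restrict (Ioc s t))).restrict (K ×ˢ univ) := by
  rw [← Measure.prod_restrict, Measure.restrict_univ]

lemma cylinderMeasure_mono {a b : ℝ} (ha : s ≤ a) (hb : b ≤ t) :
    cylinderMeasure K a b ≤ cylinderMeasure K s t :=
  Measure.prod_mono le_rfl (Measure.restrict_mono (Ioc_subset_Ioc ha hb) le_rfl)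

lemma memLp_cylinder {F : Type*} [NormedAddCommGroup F] {g : V × ℝ → F} {p : ℝ≥0∞}
    (hg : MemLp g p (volume.prod volume)) : MemLp g p (cylinderMeasure K s t) := by
  rw [cylinderMeasure_eq_restrict]
  exact (memLp_slab hg _).restrict _

lemma integral_cylinderMeasure_eq {g : V × ℝ → ℝ} (hg : ∀ z, z.1 ∉ K → g z = 0) :
    ∫ z, g z ∂(cylinderMeasure K s t) = ∫ z, g z ∂(volume.prod (volume.restrict (Ioc s t))) := by
  rw [cylinderMeasure_eq_restrict]
  exact setIntegral_eq_integral_of_forall_compl_eq_zero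
    fun z hz => hg z fun hmem => hz ⟨hmem, mem_univ _⟩

variable {η : V → ℝ} {G : V × ℝ → V}

lemma fluxIntegral_nonneg (hη0 : ∀ x, 0 ≤ η x) : 0 ≤ fluxIntegral K s t η G :=
  integral_nonneg fun _ => mul_nonneg (norm_nonneg _) (mul_nonneg (hη0 _) (norm_nonneg _))

lemma integrable_flux (hη : IsTestFunction K η) (hG : MemLp G 2 (volume.prod volume)) :
    Integrable (fun z => ‖G z‖ * (η z.1 * ‖gradient η z.1‖)) (cylinderMeasure K s t) := by
  have hprod : MemLp (fun x => η x * ‖gradient η x‖) 2 (volume.restrict K) :=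
    (hη.contDiff.continuous.mul hη.continuous_gradient.norm).memLp_of_hasCompactSupport
      hη.hasCompactSupport.mul_right
  exact (memLp_cylinder hG).norm.integrable_mul (hprod.comp_fst _)

namespace LogWeakSolutionOn

variable {u w : V × ℝ → ℝ} {F : V × ℝ → V} {Co C₁ B Y l S : ℝ}

lemma abs_mass_sub_le (D : LogWeakSolutionOn K s t u w F G) (hC₁ : 0 ≤ C₁)
    (hF : ∀ᵐ z ∂(cylinderMeasure K s t), IsEllipticFlux Co C₁ (F z) (G z))
    (hη : IsTestFunction K η) (hη0 : ∀ x, 0 ≤ η x) {a b : ℝ} (ha : s ≤ a) (hab : a < b)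
    (hb : b ≤ t) :
    |(∫ x, u (x, b) * (η x * η x)) - ∫ x, u (x, a) * (η x * η x)| ≤
      2 * C₁ * fluxIntegral K s t η G := by
  have hζ : IsTestFunction K fun x => η x * η x := hη.mul_left hη.contDiff
  have hmono := cylinderMeasure_mono (K := K) ha hb
  have hintegrable := (integrable_flux (s := s) (t := t) hη D.memLp_G).const_mul (2 * C₁)
  have hout : ∀ z : V × ℝ, z.1 ∉ K →
      inner ℝ (F z) (gradient (fun x => η x * η x) z.1) = 0 := fun z hz => by
    simp [gradient_mul_self hη.differentiable, hη.eq_zero_of_notMem hz]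
  rw [eq_neg_of_add_eq_zero_left (D.equation _ hζ a b ha hab hb), abs_neg,
    ← integral_cylinderMeasure_eq hout, fluxIntegral, ← integral_const_mul, ← Real.norm_eq_abs]
  refine (norm_integral_le_of_norm_le (hintegrable.mono_measure hmono) ?_).trans
    (integral_mono_measure hmono (ae_of_all _ fun z => ?_) hintegrable)
  · filter_upwards [(Measure.absolutelyContinuous_of_le hmono).ae_le hF] with z hz
    exact hz.abs_inner_gradient_mul_self_le hη.differentiable (hη0 _)
  · have := hη0 z.1
    positivity

lemma mass_le_add_fluxIntegral (D : LogWeakSolutionOn K s t u w F G) (hC₁ : 0 ≤ C₁)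
    (hF : ∀ᵐ z ∂(cylinderMeasure K s t), IsEllipticFlux Co C₁ (F z) (G z))
    (hη : IsTestFunction K η) (hη0 : ∀ x, 0 ≤ η x) {a b : ℝ} (ha : a ∈ Icc s t)
    (hb : b ∈ Icc s t) :
    ∫ x, u (x, a) * (η x * η x) ≤
      (∫ x, u (x, b) * (η x * η x)) + 2 * C₁ * fluxIntegral K s t η G := by
  rcases lt_trichotomy a b with hab | rfl | hba
  · linarith [(abs_le.1 (D.abs_mass_sub_le hC₁ hF hη hη0 ha.1 hab hb.2)).1]
  · have hflux := fluxIntegral_nonneg (K := K) (s := s) (t := t) (G := G) hη0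
    exact le_add_of_nonneg_right (by positivity)
  · linarith [(abs_le.1 (D.abs_mass_sub_le hC₁ hF hη hη0 hb.1 hba ha.2)).2]

lemma fluxIntegral_le (D : LogWeakSolutionOn K s t u w F G) (hK : volume K ≠ ⊤) (hst : s < t)
    (hCo : 0 < Co) (hF : ∀ᵐ z ∂(cylinderMeasure K s t), IsEllipticFlux Co C₁ (F z) (G z))
    (hη : IsTestFunction (interior K) η) (hη0 : ∀ x, 0 ≤ η x) (hB : ∀ x, ‖gradient η x‖ ≤ B)
    (hY : ∫ z, (1 + (w z - l) ^ 2) ∂(cylinderMeasure K s t) ≤ Y)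
    (hS : ∀ᵐ τ ∂(volume.restrict (Ioc s t)), ∫ x, u (x, τ) * (η x * η x) ≤ S) :
    20 * C₁ * fluxIntegral K s t η G ≤ 2 * (2 * S) + 144 * C₁ ^ 2 / Co * B ^ 2 * Y := by
  have hηK : IsTestFunction K η := hη.mono interior_subset
  have hζ : IsTestFunction (interior K) fun x => η x * η x := hη.mul_left hη.contDiff
  have hf := smoothBounded_arctan_sub l
  let Φ : V × ℝ → V := fun z =>
    testGradient (fun a => Real.arctan (a - l)) (fun x => η x * η x) (w z) (G z) z.1
  have hΦ_out z (hz : z.1 ∉ K) : inner ℝ (F z) (Φ z) = 0 := by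
    simp [Φ, testGradient, gradient_mul_self hη.differentiable, hηK.eq_zero_of_notMem hz]
  have henergy : ∫ z, inner ℝ (F z) (Φ z) ∂(cylinderMeasure K s t) ≤ 2 * (2 * S) := by
    rw [integral_cylinderMeasure_eq hΦ_out]
    exact D.energy_le hst hf
      (fun a b hab => Real.arctan_strictMono.monotone (sub_le_sub_right hab l)) hζ
      (fun x => mul_self_nonneg _) hS
  have hFΦ : Integrable (fun z => inner ℝ (F z) (Φ z)) (cylinderMeasure K s t) := by
    rw [cylinderMeasure_eq_restrict]
    exact (integrable_inner_of_memLp (memLp_slab D.memLp_F _)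
      (D.memLp_testGradient_slab hf hζ s t)).restrict
  have : IsFiniteMeasure (volume.restrict K) := isFiniteMeasure_restrict.2 hK
  have hw : Integrable (fun z => 1 + (w z - l) ^ 2) (cylinderMeasure K s t) :=
    (integrable_const _).add ((memLp_cylinder D.memLp_w).sub (memLp_const l)).integrable_sq
  calc 20 * C₁ * fluxIntegral K s t η G
      ≤ ∫ z, (inner ℝ (F z) (Φ z) + 144 * C₁ ^ 2 / Co * B ^ 2 * (1 + (w z - l) ^ 2))
          ∂(cylinderMeasure K s t) := by
        rw [fluxIntegral, ← integral_const_mul]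
        refine integral_mono_ae ((integrable_flux hηK D.memLp_G).const_mul _)
          (hFΦ.add (hw.const_mul _)) ?_
        filter_upwards [hF] with z hz
        exact hz.mul_le_inner_testGradient_arctan hCo hη.differentiable (hη0 _) (hB _) l (w z)
    _ ≤ 2 * (2 * S) + 144 * C₁ ^ 2 / Co * B ^ 2 * Y := by
        rw [integral_add hFΦ (hw.const_mul _), integral_const_mul]
        gcongr

lemma mass_le (D : LogWeakSolutionOn K s t u w F G) (hK : volume K ≠ ⊤) (hst : s < t)
    (hCo : 0 < Co) (hC₁ : 0 ≤ C₁)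
    (hF : ∀ᵐ z ∂(cylinderMeasure K s t), IsEllipticFlux Co C₁ (F z) (G z))
    (hη : IsTestFunction (interior K) η) (hη0 : ∀ x, 0 ≤ η x) (hB : ∀ x, ‖gradient η x‖ ≤ B)
    (hY : ∫ z, (1 + (w z - l) ^ 2) ∂(cylinderMeasure K s t) ≤ Y)
    {τ₁ τ₂ : ℝ} (h₁ : τ₁ ∈ Icc s t) (h₂ : τ₂ ∈ Icc s t) :
    ∫ x, u (x, τ₁) * (η x * η x) ≤
      5 / 3 * (∫ x, u (x, τ₂) * (η x * η x)) + 24 * C₁ ^ 2 / Co * (B ^ 2 * Y) := by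
  have hmass {τ : ℝ} (hτ : τ ∈ Icc s t) :=
    D.mass_le_add_fluxIntegral hC₁ hF (hη.mono interior_subset) hη0 hτ h₂
  have hflux := D.fluxIntegral_le hK hst hCo hF hη hη0 hB hY <| by
    filter_upwards [ae_restrict_mem measurableSet_Ioc] with τ hτ
    exact hmass (Ioc_subset_Icc_self hτ)
  have hconst : 144 * C₁ ^ 2 / Co * B ^ 2 * Y = 6 * (24 * C₁ ^ 2 / Co * (B ^ 2 * Y)) := by ring
  linarith [hmass h₁]

end LogWeakSolutionOn

end WeightedMass

section Cubes

variable {N : ℕ}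

lemma cube_eq_preimage (y : Sp N) (ρ : ℝ) :
    cube y ρ = (MeasurableEquiv.toLp 2 (Fin N → ℝ)).symm ⁻¹'
      (Set.pi univ fun i => Icc (y i - ρ / 2) (y i + ρ / 2)) := by
  ext x
  rw [mem_preimage, Set.mem_univ_pi]
  refine forall_congr' fun i => ?_
  change |x i - y i| ≤ ρ / 2 ↔ y i - ρ / 2 ≤ x i ∧ x i ≤ y i + ρ / 2
  rw [abs_sub_le_iff]
  constructor <;> rintro ⟨h₁, h₂⟩ <;> constructor <;> linarith

lemma volume_cube (y : Sp N) (ρ : ℝ) : volume (cube y ρ) = ENNReal.ofReal ρ ^ N := by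
  rw [cube_eq_preimage,
    (EuclideanSpace.volume_preserving_symm_measurableEquiv_toLp (Fin N)).measure_preimage_equiv,
    volume_pi_pi]
  simp only [Real.volume_Icc]
  ring_nf
  simp

lemma isCompact_cube (y : Sp N) (ρ : ℝ) : IsCompact (cube y ρ) := by
  have hpreimage : cube y ρ = (EuclideanSpace.equiv (Fin N) ℝ).toHomeomorph ⁻¹'
      (Set.pi univ fun i => Icc (y i - ρ / 2) (y i + ρ / 2)) := cube_eq_preimage y ρ
  rw [hpreimage, Homeomorph.isCompact_preimage]
  exact isCompact_univ_pi fun i => isCompact_Icc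

lemma subset_interior_cube (y : Sp N) (ρ : ℝ) :
    {x : Sp N | ∀ i, |x i - y i| < ρ / 2} ⊆ interior (cube y ρ) := by
  refine interior_maximal (fun x hx i => (hx i).le) ?_
  simp only [ofPred_forall]
  exact isOpen_iInter_of_finite fun i => isOpen_lt (by fun_prop) continuous_const

lemma self_mem_cube (y : Sp N) {ρ : ℝ} (hρ : 0 ≤ ρ) : y ∈ cube y ρ := fun i => by
  simpa using div_nonneg hρ zero_le_two

lemma cube_subset_cube (y : Sp N) {ρ ρ' : ℝ} (h : ρ ≤ ρ') : cube y ρ ⊆ cube y ρ' :=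
  fun _ hx i => (hx i).trans (by linarith)

lemma inv_smul_sub_mem_cube_iff {x y : Sp N} {ρ σ : ℝ} (hρ : 0 < ρ) :
    ρ⁻¹ • (x - y) ∈ cube 0 σ ↔ x ∈ cube y (σ * ρ) := by
  refine forall_congr' fun i => ?_
  rw [PiLp.smul_apply, PiLp.sub_apply, PiLp.zero_apply, smul_eq_mul, sub_zero, abs_mul, abs_inv,
    abs_of_pos hρ, inv_mul_le_iff₀ hρ, mul_div_assoc', mul_comm ρ]

lemma volume_cube_ne_zero (y : Sp N) {ρ : ℝ} (hρ : 0 < ρ) : volume (cube y ρ) ≠ 0 := by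
  rw [volume_cube]
  exact pow_ne_zero _ (by simpa using hρ)

lemma volume_cube_ne_top (y : Sp N) (ρ : ℝ) : volume (cube y ρ) ≠ ⊤ :=
  (isCompact_cube y ρ).measure_lt_top.ne

end Cubes

section Laplacian

variable {V : Type*} [NormedAddCommGroup V] [InnerProductSpace ℝ V] [FiniteDimensional ℝ V]
  {f : V → ℝ}

lemma laplacian_apply (f : V → ℝ) (x : V) :
    Laplacian.laplacian f x = ∑ i, iteratedFDeriv ℝ 2 f x
      ![stdOrthonormalBasis ℝ V i, stdOrthonormalBasis ℝ V i] := by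
  rw [InnerProductSpace.laplacian_eq_iteratedFDeriv_stdOrthonormalBasis]

lemma laplacian_comp_smul_sub (hf : ContDiff ℝ 2 f) (a : ℝ) (x y : V) :
    Laplacian.laplacian (fun x => f (a • (x - y))) x =
      a ^ 2 * Laplacian.laplacian f (a • (x - y)) := by
  simp only [laplacian_apply, Finset.mul_sum,
    iteratedFDeriv_comp_sub (f := fun z => f (a • z)), iteratedFDeriv_comp_const_smul a hf,
    _root_.smul_apply, smul_eq_mul]

lemma laplacian_eq_zero_of_notMem {x : V} (hx : x ∉ tsupport f) :
    Laplacian.laplacian f x = 0 := by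
  have hderiv : iteratedFDeriv ℝ 2 f x = 0 :=
    image_eq_zero_of_notMem_tsupport fun h => hx (tsupport_iteratedFDeriv_subset 2 h)
  simp [laplacian_apply, hderiv]

lemma hasCompactSupport_laplacian (hf : HasCompactSupport f) :
    HasCompactSupport (Laplacian.laplacian f) :=
  HasCompactSupport.intro hf.isCompact fun _ hx => laplacian_eq_zero_of_notMem hx

lemma continuous_laplacian (hf : ContDiff ℝ 2 f) : Continuous (Laplacian.laplacian f) := by
  rw [funext (laplacian_apply f)]
  fun_prop

variable [MeasurableSpace V] [BorelSpace V]

lemma integral_fderiv_apply_eq_zero (hf : ContDiff ℝ 1 f) (hfc : HasCompactSupport f) (v : V) :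
    ∫ x, fderiv ℝ f x v = 0 := by
  have hderiv : Integrable (fun x => fderiv ℝ f x v) :=
    ((hf.continuous_fderiv (by simp)).clm_apply continuous_const).integrable_of_hasCompactSupport
      ((hfc.fderiv ℝ).comp_left (g := fun L : V →L[ℝ] ℝ => L v) (by simp))
  simpa using integral_mul_fderiv_eq_neg_fderiv_mul_of_integrable (μ := (volume : Measure V))
    (f := fun _ => (1 : ℝ)) (g := f) (v := v) (by simp) (by simpa using hderiv)
    (by simpa using hf.continuous.integrable_of_hasCompactSupport hfc) (by simp)
    fun x _ => hf.differentiable (by simp) x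

lemma integral_laplacian (hf : ContDiff ℝ 2 f) (hfc : HasCompactSupport f) :
    ∫ x, Laplacian.laplacian f x = 0 := by
  have hf' : ContDiff ℝ 1 (fderiv ℝ f) := hf.fderiv_right (by norm_num)
  have happly (v x : V) :
      iteratedFDeriv ℝ 2 f x ![v, v] = fderiv ℝ (fun x => fderiv ℝ f x v) x v := by
    rw [iteratedFDeriv_two_apply,
      fderiv_clm_apply (hf'.differentiable (by simp) x) (differentiableAt_const _)]
    simp
  have hint (v : V) : Integrable fun x => iteratedFDeriv ℝ 2 f x ![v, v] :=
    Continuous.integrable_of_hasCompactSupport (by fun_prop)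
      ((hfc.iteratedFDeriv 2).comp_left (g := fun L : V [×2]→L[ℝ] ℝ => L ![v, v]) (by simp))
  have hzero (v : V) : ∫ x, iteratedFDeriv ℝ 2 f x ![v, v] = 0 := by
    simp only [happly]
    exact integral_fderiv_apply_eq_zero (hf'.clm_apply contDiff_const)
      ((hfc.fderiv ℝ).comp_left (g := fun L : V →L[ℝ] ℝ => L v) (by simp)) v
  simp_rw [laplacian_apply]
  rw [integral_finsetSum _ fun i _ => hint _]
  simp [hzero]

end Laplacian

section Cutoff

variable {N : ℕ} {C ρ : ℝ} {y : Sp N} {η : Sp N → ℝ}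

/-- `η` is a smooth cutoff function between `K_ρ(y)` and `K_{2ρ}(y)` whose derivatives are
controlled by the constant `C` at the scale `ρ`. -/
structure IsCubeCutoff (C : ℝ) (y : Sp N) (ρ : ℝ) (η : Sp N → ℝ) : Prop extends
    IsTestFunction (interior (cube y (2 * ρ))) η where
  nonneg : ∀ x, 0 ≤ η x
  le_one : ∀ x, η x ≤ 1
  eq_one : ∀ x ∈ cube y ρ, η x = 1
  norm_gradient_le : ∀ x, ‖gradient η x‖ ≤ C / ρ
  abs_laplacian_le : ∀ x, |Laplacian.laplacian η x| ≤ C / ρ ^ 2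

lemma IsCubeCutoff.bound_nonneg (hη : IsCubeCutoff C y ρ η) (hρ : 0 < ρ) : 0 ≤ C := by
  have h : 0 ≤ C / ρ := (norm_nonneg _).trans (hη.norm_gradient_le y)
  rwa [le_div_iff₀ hρ, zero_mul] at h

lemma exists_smooth_cutoff_unit_cube (N : ℕ) :
    ∃ η : Sp N → ℝ, IsTestFunction (interior (cube 0 2)) η ∧ (∀ x, 0 ≤ η x) ∧ (∀ x, η x ≤ 1) ∧
      ∀ x ∈ cube 0 1, η x = 1 := by
  let b : ContDiffBump (0 : ℝ) := ⟨1 / 2, 3 / 4, by norm_num, by norm_num⟩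
  have hsupp : tsupport (fun x : Sp N => ∏ i, b (x i)) ⊆ cube 0 (3 / 2) := by
    refine closure_minimal (fun x hx i => ?_) (isCompact_cube _ _).isClosed
    have hmem : x i ∈ Function.support b := Finset.prod_ne_zero_iff.1 hx i (Finset.mem_univ i)
    rw [b.support_eq, mem_ball_zero_iff, Real.norm_eq_abs] at hmem
    exact (by simpa using hmem.le : |x i - (0 : Sp N) i| ≤ 3 / 4).trans (by norm_num)
  have hinterior : cube (0 : Sp N) (3 / 2) ⊆ interior (cube 0 2) := fun x hx =>
    subset_interior_cube 0 2 fun i => (hx i).trans_lt (by norm_num)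
  refine ⟨fun x => ∏ i, b (x i), ⟨?_, ?_, hsupp.trans hinterior⟩, fun x => ?_, fun x => ?_,
    fun x hx => ?_⟩
  · exact contDiff_prod fun i _ => b.contDiff.comp (by fun_prop)
  · exact (isCompact_cube 0 _).of_isClosed_subset (isClosed_tsupport _) hsupp
  · exact Finset.prod_nonneg fun i _ => b.nonneg
  · exact Finset.prod_le_one (fun i _ => b.nonneg) fun i _ => b.le_one
  · exact Finset.prod_eq_one fun i _ => b.one_of_mem_closedBall (by simpa [b] using hx i)

lemma exists_isCubeCutoff_one (N : ℕ) :
    ∃ (C : ℝ) (η : Sp N → ℝ), IsCubeCutoff C 0 1 η := by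
  obtain ⟨η, hη, hη0, hη1, hη_one⟩ := exists_smooth_cutoff_unit_cube N
  obtain ⟨A, hA⟩ := hη.hasCompactSupport_gradient.exists_bound_of_continuous hη.continuous_gradient
  obtain ⟨B, hB⟩ := (hasCompactSupport_laplacian hη.hasCompactSupport).exists_bound_of_continuous
    (continuous_laplacian (contDiff_infty.1 hη.contDiff 2))
  refine ⟨max A B, η, ⟨by simpa using hη, hη0, hη1, hη_one, fun x => ?_, fun x => ?_⟩⟩
  · simpa using Or.inl (hA x)
  · simpa using Or.inr (hB x)

lemma IsCubeCutoff.rescale (hη : IsCubeCutoff C 0 1 η) (y : Sp N) (hρ : 0 < ρ) :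
    IsCubeCutoff C y ρ fun x => η (ρ⁻¹ • (x - y)) := by
  have hcont : Continuous fun x : Sp N => ρ⁻¹ • (x - y) := by fun_prop
  have hpreimage : (fun x : Sp N => ρ⁻¹ • (x - y)) ⁻¹' cube 0 (2 * 1) = cube y (2 * ρ) := by
    ext x
    rw [mem_preimage, inv_smul_sub_mem_cube_iff hρ, mul_one]
  have hsupp : tsupport (fun x => η (ρ⁻¹ • (x - y))) ⊆ interior (cube y (2 * ρ)) := by
    rw [← hpreimage]
    exact ((tsupport_comp_subset_preimage η hcont).trans (preimage_mono hη.tsupport_subset)).trans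
      (preimage_interior_subset_interior_preimage hcont)
  refine ⟨⟨hη.contDiff.comp (by fun_prop), ?_, hsupp⟩, fun x => hη.nonneg _, fun x => hη.le_one _,
    fun x hx => hη.eq_one _ ((inv_smul_sub_mem_cube_iff hρ).2 (by rwa [one_mul])), fun x => ?_,
    fun x => ?_⟩
  · exact (isCompact_cube y _).of_isClosed_subset (isClosed_tsupport _)
      (hsupp.trans interior_subset)
  · have hbound := hη.norm_gradient_le (ρ⁻¹ • (x - y))
    rw [norm_gradient, div_one] at hbound
    rw [norm_gradient, fderiv_comp_sub (f := fun z => η (ρ⁻¹ • z)), fderiv_comp_smul, norm_smul,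
      norm_inv, Real.norm_of_nonneg hρ.le, inv_mul_eq_div]
    gcongr
  · have hbound := hη.abs_laplacian_le (ρ⁻¹ • (x - y))
    rw [one_pow, div_one] at hbound
    rw [laplacian_comp_smul_sub (contDiff_infty.1 hη.contDiff 2), abs_mul,
      abs_of_nonneg (by positivity), inv_pow, inv_mul_eq_div]
    gcongr

end Cutoff

section Averages

variable {α F : Type*} [MeasurableSpace α] {μ : Measure α} [NormedAddCommGroup F] {K : Set α}

lemma setIntegral_eq_measureReal_mul_integral_cond (hK₀ : μ K ≠ 0) (hK : μ K ≠ ⊤) (f : α → ℝ) :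
    ∫ x in K, f x ∂μ = μ.real K * ∫ x, f x ∂(ProbabilityTheory.cond μ K) := by
  rw [ProbabilityTheory.cond, integral_smul_measure, ENNReal.toReal_inv, smul_eq_mul,
    measureReal_def, mul_inv_cancel_left₀ (ENNReal.toReal_ne_zero.2 ⟨hK₀, hK⟩)]

lemma laverage_rpow_eq_eLpNorm_cond (g : α → ℝ) {q : ℝ} (hq : 0 < q) :
    (⨍⁻ x in K, ENNReal.ofReal |g x| ^ q ∂μ) ^ (1 / q) =
      eLpNorm g (ENNReal.ofReal q) (ProbabilityTheory.cond μ K) := by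
  rw [eLpNorm_eq_lintegral_rpow_enorm_toReal (by simpa using hq) ENNReal.ofReal_ne_top,
    ENNReal.toReal_ofReal hq.le]
  simp only [laverage, Measure.restrict_apply_univ, ProbabilityTheory.cond,
    Real.enorm_eq_ofReal_abs]

lemma eLpNorm_cond_sub_const_le {g : α → F} {p : ℝ≥0∞} (hp : 1 ≤ p) (hp' : p ≠ ⊤)
    (hK₀ : μ K ≠ 0) (hK : μ K ≠ ⊤) (hg : AEStronglyMeasurable g (μ.restrict K)) (c : F) :
    eLpNorm (fun x => g x - c) p (ProbabilityTheory.cond μ K) ≤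
      (μ K)⁻¹ ^ (1 / p).toReal * eLpNorm g p (μ.restrict K) + ‖c‖ₑ := by
  have hprob := ProbabilityTheory.cond_isProbabilityMeasure_of_finite hK₀ hK
  calc eLpNorm (fun x => g x - c) p (ProbabilityTheory.cond μ K)
      ≤ eLpNorm g p (ProbabilityTheory.cond μ K) +
          eLpNorm (fun _ => c) p (ProbabilityTheory.cond μ K) :=
        eLpNorm_sub_le (hg.smul_measure _) aestronglyMeasurable_const hp
    _ = (μ K)⁻¹ ^ (1 / p).toReal * eLpNorm g p (μ.restrict K) + ‖c‖ₑ := by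
        rw [eLpNorm_const c (one_pos.trans_le hp).ne' hprob.ne_zero, measure_univ,
          ENNReal.one_rpow, mul_one, ProbabilityTheory.cond,
          eLpNorm_smul_measure_of_ne_top hp', smul_eq_mul]

variable [IsProbabilityMeasure μ] {f : α → ℝ} {Λ : ℝ}

lemma integral_abs_le_of_eLpNorm_le {q : ℝ≥0∞} (hf : AEStronglyMeasurable f μ) (hq : 1 ≤ q)
    (hΛ : 0 ≤ Λ) (h : eLpNorm f q μ ≤ ENNReal.ofReal Λ) :
    Integrable f μ ∧ ∫ x, |f x| ∂μ ≤ Λ := by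
  have hle : ∫⁻ x, ‖f x‖ₑ ∂μ ≤ ENNReal.ofReal Λ := by
    rw [← eLpNorm_one_eq_lintegral_enorm]
    exact (eLpNorm_le_eLpNorm_of_exponent_le hq hf).trans h
  refine ⟨⟨hf, hle.trans_lt ENNReal.ofReal_lt_top⟩, ?_⟩
  simp only [← Real.norm_eq_abs]
  rw [integral_norm_eq_lintegral_enorm hf]
  exact ENNReal.toReal_le_of_le_ofReal hΛ hle

lemma integral_one_add_sq_le_of_eLpNorm_le (hf : AEStronglyMeasurable f μ) (hΛ : 0 ≤ Λ)
    (h : eLpNorm f 2 μ ≤ ENNReal.ofReal Λ) :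
    ∫ x, (1 + f x ^ 2) ∂μ ≤ 1 + Λ ^ 2 := by
  have hL2 : MemLp f 2 μ := ⟨hf, h.trans_lt ENNReal.ofReal_lt_top⟩
  have hsq : ∫ x, f x ^ 2 ∂μ ≤ Λ ^ 2 := by
    rw [integral_eq_lintegral_of_nonneg_ae (ae_of_all _ fun _ => sq_nonneg _) (hf.pow 2)]
    refine ENNReal.toReal_le_of_le_ofReal (sq_nonneg Λ) ?_
    simp only [← Real.enorm_of_nonneg (sq_nonneg (f _)), enorm_pow]
    rw [← eLpNorm_two_sq, ENNReal.ofReal_pow hΛ]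
    gcongr
  rw [integral_add (integrable_const _) hL2.integrable_sq]
  simpa using hsq

end Averages

section Subcylinder

variable {N : ℕ} {E : Set (Sp N)} {T : ℝ} {u : Sp N → ℝ → ℝ} {y : Sp N} {ρ s t : ℝ}

/-- `K_{2ρ}(y) × [s, t]` is a nondegenerate closed cylinder contained in `E_T`. -/
structure IsSubcylinder (E : Set (Sp N)) (T : ℝ) (y : Sp N) (ρ s t : ℝ) : Prop where
  pos : 0 < ρ
  lt : s < t
  subset : cube y (2 * ρ) ×ˢ Icc s t ⊆ cyl E T

namespace IsSubcylinder

lemma center_mem (Q : IsSubcylinder E T y ρ s t) : y ∈ cube y (2 * ρ) :=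
  self_mem_cube y (by linarith [Q.pos])

lemma start_pos (Q : IsSubcylinder E T y ρ s t) : 0 < s :=
  (Q.subset (mk_mem_prod Q.center_mem (left_mem_Icc.2 Q.lt.le))).2.1

lemma end_le (Q : IsSubcylinder E T y ρ s t) : t ≤ T :=
  (Q.subset (mk_mem_prod Q.center_mem (right_mem_Icc.2 Q.lt.le))).2.2

lemma cube_subset (Q : IsSubcylinder E T y ρ s t) : cube y (2 * ρ) ⊆ E := fun _ hx =>
  (Q.subset (mk_mem_prod hx (left_mem_Icc.2 Q.lt.le))).1

lemma volume_cube_ne_zero (Q : IsSubcylinder E T y ρ s t) : volume (cube y (2 * ρ)) ≠ 0 :=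
  LogDiffusion.volume_cube_ne_zero y (by linarith [Q.pos])

lemma isProbabilityMeasure_cond (Q : IsSubcylinder E T y ρ s t) :
    IsProbabilityMeasure (ProbabilityTheory.cond volume (cube y (2 * ρ))) :=
  ProbabilityTheory.cond_isProbabilityMeasure_of_finite Q.volume_cube_ne_zero
    (volume_cube_ne_top y _)

lemma measureReal_cube (Q : IsSubcylinder E T y ρ s t) :
    volume.real (cube y (2 * ρ)) = (2 * ρ) ^ N := by
  rw [measureReal_def, volume_cube, ENNReal.toReal_pow,
    ENNReal.toReal_ofReal (by linarith [Q.pos])]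

end IsSubcylinder

lemma isCompact_cube_prod_Icc (y : Sp N) (ρ s t : ℝ) : IsCompact (cube y ρ ×ˢ Icc s t) :=
  (isCompact_cube _ _).prod isCompact_Icc

lemma restrict_prod_Ioc (K : Set (Sp N)) (s t : ℝ) :
    volume.restrict (K ×ˢ Ioc s t) = cylinderMeasure K s t :=
  (Measure.prod_restrict K (Ioc s t)).symm

lemma restrict_prod_Icc (K : Set (Sp N)) (s t : ℝ) :
    volume.restrict (K ×ˢ Icc s t) = cylinderMeasure K s t := by
  rw [cylinderMeasure, restrict_Ioc_eq_restrict_Icc]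
  exact (Measure.prod_restrict K (Icc s t)).symm

lemma MemLpLoc.memLp_cylinderMeasure {F : Type*} [NormedAddCommGroup F] {f : Sp N → ℝ → F}
    {q : ℝ≥0∞} (hf : MemLpLoc E T f q) (Q : IsSubcylinder E T y ρ s t) :
    MemLp (fun z : Sp N × ℝ => f z.1 z.2) q (cylinderMeasure (cube y (2 * ρ)) s t) := by
  rw [← restrict_prod_Icc]
  exact hf _ (isCompact_cube_prod_Icc _ _ _ _) Q.subset

lemma IsSubcylinder.cylinderMeasure_le (Q : IsSubcylinder E T y ρ s t) :
    cylinderMeasure (cube y (2 * ρ)) s t ≤ volume.restrict (cyl E T) := by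
  rw [← restrict_prod_Icc]
  exact Measure.restrict_mono Q.subset le_rfl

lemma NonnegLogFinite.ae_pos (hu : NonnegLogFinite E T u) (Q : IsSubcylinder E T y ρ s t) :
    ∀ᵐ z ∂(cylinderMeasure (cube y (2 * ρ)) s t), 0 < u z.1 z.2 := by
  refine ae_mono Q.cylinderMeasure_le ?_
  filter_upwards [hu.nonneg, hu.ne_zero] with z hz hz'
  exact hz.lt_of_ne' hz'

end Subcylinder

section LogDeviation

variable {N : ℕ} {E : Set (Sp N)} {T : ℝ} {u : Sp N → ℝ → ℝ} {y : Sp N} {ρ s t p q : ℝ}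

/-- `u ≥ 0` is locally bounded in `E_T`, and `ln u ∈ L^∞_loc(0, T; L^p_loc(E))`. -/
structure HasLogBounds (E : Set (Sp N)) (T : ℝ) (u : Sp N → ℝ → ℝ) (p : ℝ) : Prop where
  nonnegLogFinite : NonnegLogFinite E T u
  memLp_top : MemLpLoc E T u ⊤
  memLinftyLp_log : MemLinftyLpLoc E T (fun x τ => Real.log (u x τ)) p

/-- `ln (u / M)` on `K_{2ρ}(y) × [s, t]`, written as `ln u - ln M`. -/
noncomputable def logDeviation (u : Sp N → ℝ → ℝ) (y : Sp N) (ρ s t : ℝ) (x : Sp N) (τ : ℝ) : ℝ :=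
  Real.log (u x τ) - Real.log (supM u y ρ s t)

lemma Lam_nonneg (u : Sp N → ℝ → ℝ) (y : Sp N) (ρ s t q : ℝ) : 0 ≤ Lam u y ρ s t q :=
  ENNReal.toReal_nonneg

namespace HasLogBounds

lemma supM_pos (hu : HasLogBounds E T u p) (Q : IsSubcylinder E T y ρ s t) :
    0 < supM u y ρ s t := by
  rw [supM, restrict_prod_Ioc]
  refine ENNReal.toReal_pos (fun h0 => ?_) (ne_of_lt ?_)
  · have hfalse : ∀ᵐ _ ∂(cylinderMeasure (cube y (2 * ρ)) s t), False := by
      filter_upwards [ENNReal.essSup_eq_zero_iff.1 h0, hu.nonnegLogFinite.ae_pos Q] with _ hz hpos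
      exact hpos.not_ge (ENNReal.ofReal_eq_zero.1 hz)
    have hzero : cylinderMeasure (cube y (2 * ρ)) s t (univ ×ˢ univ) = 0 := by
      rw [ae_eq_bot.1 (eventually_false_iff_eq_bot.1 hfalse), Measure.coe_zero, Pi.zero_apply]
    rw [cylinderMeasure, Measure.prod_prod, Measure.restrict_apply_univ,
      Measure.restrict_apply_univ, Real.volume_Ioc, mul_eq_zero, ENNReal.ofReal_eq_zero] at hzero
    exact hzero.elim Q.volume_cube_ne_zero fun h => by linarith [Q.lt]
  · have htop := (hu.memLp_top.memLp_cylinderMeasure Q).2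
    rw [eLpNorm_exponent_top, eLpNormEssSup] at htop
    refine (essSup_mono_ae (ae_of_all _ fun z => ?_)).trans_lt htop
    rw [Real.enorm_eq_ofReal_abs]
    exact ENNReal.ofReal_le_ofReal (le_abs_self _)

lemma ae_aestronglyMeasurable_log (hu : HasLogBounds E T u p) (Q : IsSubcylinder E T y ρ s t) :
    ∀ᵐ τ ∂(volume.restrict (Ioc s t)),
      AEStronglyMeasurable (fun x => Real.log (u x τ)) (volume.restrict (cube y (2 * ρ))) :=
  (hu.memLinftyLp_log.1.mono_measure Q.cylinderMeasure_le).prod_swap.prodMk_left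

lemma Lam_eq (hu : HasLogBounds E T u p) (Q : IsSubcylinder E T y ρ s t) (hq : 0 < q) :
    Lam u y ρ s t q = (essSup
      (fun τ => eLpNorm (fun x => logDeviation u y ρ s t x τ) (ENNReal.ofReal q)
        (ProbabilityTheory.cond volume (cube y (2 * ρ)))) (volume.restrict (Ioc s t))).toReal := by
  rw [Lam, ← restrict_Ioc_eq_restrict_Icc]
  congr 1
  refine essSup_congr_ae ?_
  filter_upwards [ae_slice_of_ae_prod (hu.nonnegLogFinite.ae_pos Q)] with τ hτ
  rw [laverage_rpow_eq_eLpNorm_cond _ hq]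
  refine eLpNorm_congr_ae (Measure.smul_absolutelyContinuous.ae_le ?_)
  filter_upwards [hτ] with x hx
  exact Real.log_div hx.ne' (hu.supM_pos Q).ne'

lemma essSup_logDeviation_lt_top (hu : HasLogBounds E T u p) (Q : IsSubcylinder E T y ρ s t)
    (hp : 1 ≤ p) (hqp : q ≤ p) :
    essSup (fun τ => eLpNorm (fun x => logDeviation u y ρ s t x τ) (ENNReal.ofReal q)
      (ProbabilityTheory.cond volume (cube y (2 * ρ)))) (volume.restrict (Ioc s t)) < ⊤ := by
  have hprob := Q.isProbabilityMeasure_cond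
  have hK : volume (cube y (2 * ρ)) ≠ ⊤ := volume_cube_ne_top y _
  set A := essSup (fun τ => eLpNorm (fun x => Real.log (u x τ)) (ENNReal.ofReal p)
    (volume.restrict (cube y (2 * ρ)))) (volume.restrict (Ioc s t)) with hA
  have hA_lt : A < ⊤ := by
    rw [hA, restrict_Ioc_eq_restrict_Icc]
    exact hu.memLinftyLp_log.2 _ (isCompact_cube _ _) Q.cube_subset s t Q.start_pos Q.end_le
  refine (essSup_le_of_ae_le ((volume (cube y (2 * ρ)))⁻¹ ^ (1 / ENNReal.ofReal p).toReal * A +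
    ‖Real.log (supM u y ρ s t)‖ₑ) ?_).trans_lt ?_
  · filter_upwards [hu.ae_aestronglyMeasurable_log Q, ENNReal.ae_le_essSup
      (μ := volume.restrict (Ioc s t)) fun τ => eLpNorm (fun x => Real.log (u x τ))
        (ENNReal.ofReal p) (volume.restrict (cube y (2 * ρ)))] with τ hm hτ
    have hsub : AEStronglyMeasurable (fun x => logDeviation u y ρ s t x τ)
        (ProbabilityTheory.cond volume (cube y (2 * ρ))) :=
      (hm.sub aestronglyMeasurable_const).smul_measure _
    refine (eLpNorm_le_eLpNorm_of_exponent_le (ENNReal.ofReal_le_ofReal hqp) hsub).trans ?_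
    refine (eLpNorm_cond_sub_const_le (by simpa using hp) ENNReal.ofReal_ne_top
      Q.volume_cube_ne_zero hK hm _).trans ?_
    gcongr
  · refine ENNReal.add_lt_top.2 ⟨ENNReal.mul_lt_top ?_ hA_lt, by simp⟩
    exact ENNReal.rpow_lt_top_of_nonneg (by positivity)
      (ENNReal.inv_ne_top.2 Q.volume_cube_ne_zero)

lemma ae_eLpNorm_logDeviation_le (hu : HasLogBounds E T u p) (Q : IsSubcylinder E T y ρ s t)
    (hq : 1 ≤ q) (hqp : q ≤ p) :
    ∀ᵐ τ ∂(volume.restrict (Ioc s t)),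
      AEStronglyMeasurable (fun x => logDeviation u y ρ s t x τ)
        (ProbabilityTheory.cond volume (cube y (2 * ρ))) ∧
      eLpNorm (fun x => logDeviation u y ρ s t x τ) (ENNReal.ofReal q)
        (ProbabilityTheory.cond volume (cube y (2 * ρ))) ≤ ENNReal.ofReal (Lam u y ρ s t q) := by
  rw [hu.Lam_eq Q (one_pos.trans_le hq),
    ENNReal.ofReal_toReal (hu.essSup_logDeviation_lt_top Q (hq.trans hqp) hqp).ne]
  filter_upwards [hu.ae_aestronglyMeasurable_log Q, ENNReal.ae_le_essSup
    (μ := volume.restrict (Ioc s t)) fun τ => eLpNorm (fun x => logDeviation u y ρ s t x τ)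
      (ENNReal.ofReal q) (ProbabilityTheory.cond volume (cube y (2 * ρ)))] with τ hm hτ
  exact ⟨(hm.sub aestronglyMeasurable_const).smul_measure _, hτ⟩

lemma ae_integral_abs_logDeviation_le (hu : HasLogBounds E T u p)
    (Q : IsSubcylinder E T y ρ s t) (hp : 1 ≤ p) :
    ∀ᵐ τ ∂(volume.restrict (Ioc s t)),
      IntegrableOn (fun x => logDeviation u y ρ s t x τ) (cube y (2 * ρ)) volume ∧
      ∫ x in cube y (2 * ρ), |logDeviation u y ρ s t x τ| ≤ (2 * ρ) ^ N * Lam u y ρ s t p := by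
  have hprob := Q.isProbabilityMeasure_cond
  have hK : volume (cube y (2 * ρ)) ≠ ⊤ := volume_cube_ne_top y _
  filter_upwards [hu.ae_eLpNorm_logDeviation_le Q hp le_rfl] with τ ⟨hm, hτ⟩
  obtain ⟨hi, hle⟩ := integral_abs_le_of_eLpNorm_le hm (by simpa using hp)
    (Lam_nonneg u y ρ s t p) hτ
  constructor
  · exact (integrable_smul_measure (ENNReal.inv_ne_zero.2 hK)
      (ENNReal.inv_ne_top.2 Q.volume_cube_ne_zero)).1 hi
  · rw [setIntegral_eq_measureReal_mul_integral_cond Q.volume_cube_ne_zero hK,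
      Q.measureReal_cube]
    have := Q.pos
    gcongr

lemma ae_integral_one_add_sq_logDeviation_le (hu : HasLogBounds E T u p)
    (Q : IsSubcylinder E T y ρ s t) (hp : 2 ≤ p) :
    ∀ᵐ τ ∂(volume.restrict (Ioc s t)),
      ∫ x in cube y (2 * ρ), (1 + logDeviation u y ρ s t x τ ^ 2) ≤
        (2 * ρ) ^ N * (1 + Lam u y ρ s t 2 ^ 2) := by
  have hprob := Q.isProbabilityMeasure_cond
  have hK : volume (cube y (2 * ρ)) ≠ ⊤ := volume_cube_ne_top y _
  filter_upwards [hu.ae_eLpNorm_logDeviation_le Q one_le_two hp] with τ ⟨hm, hτ⟩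
  rw [setIntegral_eq_measureReal_mul_integral_cond Q.volume_cube_ne_zero hK, Q.measureReal_cube]
  have := Q.pos
  gcongr
  exact integral_one_add_sq_le_of_eLpNorm_le hm (Lam_nonneg u y ρ s t 2) (by simpa using hτ)

end HasLogBounds

end LogDeviation

section WeakDerivative

lemma norm_moll_le {V F : Type*} [NormedAddCommGroup V] [InnerProductSpace ℝ V]
    [FiniteDimensional ℝ V] [MeasurableSpace V] [BorelSpace V] [NormedAddCommGroup F]
    [NormedSpace ℝ F] {g : V → F} {B : ℝ} (hg : ∀ᵐ x, ‖g x‖ ≤ B) (n : ℕ) (x : V) :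
    ‖moll n g x‖ ≤ B := by
  have hshift : ∀ᵐ v ∂(mollMeasure V n), ‖g (x - v)‖ ≤ B :=
    (withDensity_absolutelyContinuous _ _).ae_le
      ((volume.measurePreserving_sub_left x).quasiMeasurePreserving.ae hg)
  rw [moll_eq_average]
  simpa using norm_integral_le_of_norm_le_const hshift

variable {m L : ℝ → ℝ} {s t B : ℝ}

lemma isWeakGradientOn_indicator {A J : Set ℝ} (hA : MeasurableSet A)
    (hm : IntegrableOn m A volume) (hL : IntegrableOn L A volume)
    (hmL : ∀ χ, IsTestFunction J χ → ∫ τ in A, (m τ * deriv χ τ + L τ * χ τ) = 0) :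
    IsWeakGradientOn J (A.indicator m) (A.indicator L) := by
  intro χ hχ
  have hm' : IntegrableOn (fun τ => m τ * deriv χ τ) A volume :=
    hm.mul_of_top_left ((hχ.contDiff.continuous_deriv (by simp)).memLp_of_hasCompactSupport
      hχ.hasCompactSupport.deriv)
  have hL' : IntegrableOn (fun τ => L τ * χ τ) A volume := hL.mul_of_top_left hχ.memLp
  have htest := hmL χ hχ
  rw [integral_add hm' hL', ← integral_indicator hA, ← integral_indicator hA] at htest
  simp only [gradient_eq_deriv', smul_eq_mul, mul_comm (χ _), ← indicator_mul_left]
  linarith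

lemma IsWeakGradientOn.eventually_abs_moll_sub_le (hmL : IsWeakGradientOn (Ioo s t) m L)
    (hm : LocallyIntegrable m volume) (hL : ∀ᵐ τ, |L τ| ≤ B) {a b : ℝ} (ha : a ∈ Ioo s t)
    (hb : b ∈ Ioo s t) : ∀ᶠ n in atTop, |moll n m a - moll n m b| ≤ B * |a - b| := by
  obtain ⟨δ, hδ, hsub⟩ := isCompact_uIcc.exists_cthickening_subset_open isOpen_Ioo
    (ordConnected_Ioo.uIcc_subset hb ha)
  filter_upwards [(tendsto_bump_rOut ℝ).eventually (gt_mem_nhds hδ)] with n hn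
  refine (convex_uIcc b a).norm_image_sub_le_of_norm_deriv_le
    (fun x _ => (contDiff_moll hm n).differentiable (by simp) x) (fun x hx => ?_)
    left_mem_uIcc right_mem_uIcc
  rw [← gradient_eq_deriv', hmL.gradient_moll hm]
  · exact norm_moll_le hL n x
  · exact (Metric.closedBall_subset_closedBall hn.le).trans
      ((Metric.closedBall_subset_cthickening hx δ).trans hsub)

lemma IsWeakGradientOn.ae_abs_sub_le (hmL : IsWeakGradientOn (Ioo s t) m L)
    (hm : LocallyIntegrable m volume) (hL : ∀ᵐ τ, |L τ| ≤ B) :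
    ∀ᵐ a ∂(volume.restrict (Ioo s t)), ∀ᵐ b ∂(volume.restrict (Ioo s t)),
      |m a - m b| ≤ B * |a - b| := by
  filter_upwards [ae_restrict_of_ae (ae_tendsto_moll hm), ae_restrict_mem measurableSet_Ioo]
    with a hlim_a ha
  filter_upwards [ae_restrict_of_ae (ae_tendsto_moll hm), ae_restrict_mem measurableSet_Ioo]
    with b hlim_b hb
  exact le_of_tendsto (hlim_a.sub hlim_b).abs (hmL.eventually_abs_moll_sub_le hm hL ha hb)

end WeakDerivative

section Mass

variable {N : ℕ} {u : Sp N → ℝ → ℝ} {y : Sp N} {ρ ρ' τ τ₁ τ₂ c d e : ℝ} {ζ : Sp N → ℝ}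

lemma mass_le_ofReal_integral (hρ : ρ ≤ ρ')
    (hu : ∀ᵐ x ∂(volume.restrict (cube y ρ')), 0 ≤ u x τ)
    (hi : IntegrableOn (fun x => u x τ * ζ x) (cube y ρ') volume)
    (hζ0 : ∀ x, 0 ≤ ζ x) (hζ1 : ∀ x ∈ cube y ρ, ζ x = 1) :
    mass u y ρ τ ≤ ENNReal.ofReal (∫ x in cube y ρ', u x τ * ζ x) := by
  rw [ofReal_integral_eq_lintegral_ofReal hi (hu.mono fun x hx => mul_nonneg hx (hζ0 x)), mass]
  calc ∫⁻ x in cube y ρ, ENNReal.ofReal (u x τ)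
      = ∫⁻ x in cube y ρ, ENNReal.ofReal (u x τ * ζ x) :=
        setLIntegral_congr_fun (isCompact_cube y ρ).measurableSet fun x hx => by simp [hζ1 x hx]
    _ ≤ ∫⁻ x in cube y ρ', ENNReal.ofReal (u x τ * ζ x) :=
        lintegral_mono_set (cube_subset_cube y hρ)

lemma ofReal_integral_le_mass (hu : ∀ᵐ x ∂(volume.restrict (cube y ρ)), 0 ≤ u x τ)
    (hi : IntegrableOn (fun x => u x τ * ζ x) (cube y ρ) volume) (hζ0 : ∀ x, 0 ≤ ζ x)
    (hζ1 : ∀ x, ζ x ≤ 1) :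
    ENNReal.ofReal (∫ x in cube y ρ, u x τ * ζ x) ≤ mass u y ρ τ := by
  rw [ofReal_integral_eq_lintegral_ofReal hi (hu.mono fun x hx => mul_nonneg hx (hζ0 x)), mass]
  exact lintegral_mono_ae (hu.mono fun x hx => ENNReal.ofReal_le_ofReal
    (mul_le_of_le_one_right hx (hζ1 x)))

lemma mass_le_of_integral_le (hρ : ρ ≤ ρ') (hc : 0 ≤ c) (he : 0 ≤ e)
    (hu₁ : ∀ᵐ x ∂(volume.restrict (cube y ρ')), 0 ≤ u x τ₁)
    (hu₂ : ∀ᵐ x ∂(volume.restrict (cube y ρ')), 0 ≤ u x τ₂)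
    (hi₁ : IntegrableOn (fun x => u x τ₁ * ζ x) (cube y ρ') volume)
    (hi₂ : IntegrableOn (fun x => u x τ₂ * ζ x) (cube y ρ') volume)
    (hζ0 : ∀ x, 0 ≤ ζ x) (hζ_le : ∀ x, ζ x ≤ 1) (hζ1 : ∀ x ∈ cube y ρ, ζ x = 1)
    (hle : ∫ x in cube y ρ', u x τ₁ * ζ x ≤ c * (∫ x in cube y ρ', u x τ₂ * ζ x) + e * d) :
    mass u y ρ τ₁ ≤ ENNReal.ofReal (c + e) * (mass u y ρ' τ₂ + ENNReal.ofReal d) := by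
  refine (mass_le_ofReal_integral hρ hu₁ hi₁ hζ0 hζ1).trans
    ((ENNReal.ofReal_le_ofReal hle).trans (ENNReal.ofReal_add_le.trans ?_))
  rw [ENNReal.ofReal_mul hc, ENNReal.ofReal_mul he, mul_add]
  gcongr
  · exact le_add_of_nonneg_right he
  · exact ofReal_integral_le_mass hu₂ hi₂ hζ0 hζ_le
  · exact le_add_of_nonneg_left hc

end Mass

section Product

variable {V W : Type*} [NormedAddCommGroup V] [NormedAddCommGroup W]

lemma IsTestFunction.mul_prod [NormedSpace ℝ V] [NormedSpace ℝ W] {K : Set V} {J : Set W}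
    {η : V → ℝ} {χ : W → ℝ} (hη : IsTestFunction K η) (hχ : IsTestFunction J χ) :
    IsTestFunction (K ×ˢ J) fun z : V × W => η z.1 * χ z.2 := by
  have hsub : tsupport (fun z : V × W => η z.1 * χ z.2) ⊆ tsupport η ×ˢ tsupport χ :=
    closure_minimal (fun z hz => ⟨subset_tsupport _ (left_ne_zero_of_mul hz),
      subset_tsupport _ (right_ne_zero_of_mul hz)⟩)
      ((isClosed_tsupport _).prod (isClosed_tsupport _))
  exact ⟨(hη.contDiff.comp contDiff_fst).mul (hχ.contDiff.comp contDiff_snd),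
    (hη.hasCompactSupport.isCompact.prod hχ.hasCompactSupport.isCompact).of_isClosed_subset
      (isClosed_tsupport _) hsub,
    hsub.trans (prod_mono hη.tsupport_subset hχ.tsupport_subset)⟩

lemma integrable_mul_comp_of_hasCompactSupport {α : Type*} [MeasurableSpace α] {μ : Measure α}
    [MeasurableSpace V] [OpensMeasurableSpace V] {f : α → ℝ} {ψ : V → ℝ} {π : α → V}
    (hf : Integrable f μ) (hψ : Continuous ψ) (hψc : HasCompactSupport ψ) (hπ : Measurable π) :
    Integrable (fun z => f z * ψ (π z)) μ := by
  obtain ⟨C, hC⟩ := hψc.exists_bound_of_continuous hψ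
  exact hf.mul_bdd (hψ.measurable.comp hπ).aestronglyMeasurable (ae_of_all _ fun z => hC (π z))

end Product

section Distributional

variable {N : ℕ} {E : Set (Sp N)} {T : ℝ} {u : Sp N → ℝ → ℝ} {y : Sp N} {ρ s t p C : ℝ}
  {η : Sp N → ℝ}

namespace IsDistributionalSolution

lemma integrable_mul (hu : IsDistributionalSolution E T u) (Q : IsSubcylinder E T y ρ s t)
    (hη : IsTestFunction (cube y (2 * ρ)) η) :
    Integrable (fun z => u z.1 z.2 * η z.1) (cylinderMeasure (cube y (2 * ρ)) s t) :=
  integrable_mul_comp_of_hasCompactSupport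
    (memLp_one_iff_integrable.1 (hu.memLp.memLp_cylinderMeasure Q)) hη.contDiff.continuous
    hη.hasCompactSupport measurable_fst

lemma integrable_log_mul_laplacian (hu : IsDistributionalSolution E T u)
    (Q : IsSubcylinder E T y ρ s t) (hη : IsTestFunction (cube y (2 * ρ)) η) :
    Integrable (fun z => Real.log (u z.1 z.2) * Laplacian.laplacian η z.1)
      (cylinderMeasure (cube y (2 * ρ)) s t) :=
  integrable_mul_comp_of_hasCompactSupport
    (memLp_one_iff_integrable.1 (hu.memLp_log.memLp_cylinderMeasure Q))
    (continuous_laplacian (contDiff_infty.1 hη.contDiff 2))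
    (hasCompactSupport_laplacian hη.hasCompactSupport) measurable_fst

lemma integral_mul_deriv_add_eq_zero (hE : IsOpen E) (hu : IsDistributionalSolution E T u)
    (Q : IsSubcylinder E T y ρ s t) (hη : IsTestFunction (cube y (2 * ρ)) η) {χ : ℝ → ℝ}
    (hχ : IsTestFunction (Ioo s t) χ) :
    ∫ z, (u z.1 z.2 * η z.1 * deriv χ z.2 +
      Real.log (u z.1 z.2) * Laplacian.laplacian η z.1 * χ z.2)
        ∂(cylinderMeasure (cube y (2 * ρ)) s t) = 0 := by
  have hφ := hη.mul_prod hχ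
  have hsub : cube y (2 * ρ) ×ˢ Ioo s t ⊆ E ×ˢ Ioo 0 T :=
    prod_mono Q.cube_subset (Ioo_subset_Ioo Q.start_pos.le Q.end_le)
  have hderiv (z : Sp N × ℝ) :
      deriv (fun τ => η z.1 * χ τ) z.2 = η z.1 * deriv χ z.2 :=
    deriv_const_mul _ (hχ.differentiable _)
  have hlaplacian (z : Sp N × ℝ) : Laplacian.laplacian (fun x => η x * χ z.2) z.1 =
      Laplacian.laplacian η z.1 * χ z.2 := by
    have hsmul : (fun x => η x * χ z.2) = χ z.2 • η := funext fun x => mul_comm _ _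
    rw [hsmul, InnerProductSpace.laplacian_smul _ (contDiff_infty.1 hη.contDiff 2).contDiffAt,
      smul_eq_mul, mul_comm]
  have heq := hu.equation _ hφ.contDiff hφ.hasCompactSupport (hφ.tsupport_subset.trans hsub)
  simp only [hderiv, hlaplacian, ← mul_assoc] at heq
  rwa [setIntegral_eq_of_subset_of_forall_sdiff_eq_zero (hE.measurableSet.prod measurableSet_Ioo)
    hsub, Measure.volume_eq_prod, ← Measure.prod_restrict, restrict_Ioo_eq_restrict_Ioc] at heq
  rintro ⟨x, τ⟩ ⟨-, hz⟩
  rcases not_and_or.1 hz with hx | hτ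
  · have hx' : x ∉ tsupport η := fun h => hx (hη.tsupport_subset h)
    simp [image_eq_zero_of_notMem_tsupport hx', laplacian_eq_zero_of_notMem hx']
  · have hτ' : τ ∉ tsupport χ := fun h => hτ (hχ.tsupport_subset h)
    simp [image_eq_zero_of_notMem_tsupport hτ',
      image_eq_zero_of_notMem_tsupport fun h => hτ' (tsupport_deriv_subset h)]

lemma isWeakGradientOn_integral_mul (hE : IsOpen E) (hu : IsDistributionalSolution E T u)
    (Q : IsSubcylinder E T y ρ s t) (hη : IsTestFunction (cube y (2 * ρ)) η) :
    IsWeakGradientOn (Ioo s t)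
      ((Ioc s t).indicator fun τ => ∫ x in cube y (2 * ρ), u x τ * η x)
      ((Ioc s t).indicator fun τ => ∫ x in cube y (2 * ρ),
        Real.log (u x τ) * Laplacian.laplacian η x) := by
  have hmass := hu.integrable_mul Q hη
  have hflux := hu.integrable_log_mul_laplacian Q hη
  refine isWeakGradientOn_indicator measurableSet_Ioc hmass.integral_prod_right
    hflux.integral_prod_right fun χ hχ => ?_
  have hmass' := integrable_mul_comp_of_hasCompactSupport hmass
    (hχ.contDiff.continuous_deriv (by simp)) hχ.hasCompactSupport.deriv measurable_snd
  have hflux' := integrable_mul_comp_of_hasCompactSupport hflux hχ.contDiff.continuous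
    hχ.hasCompactSupport measurable_snd
  refine Eq.trans (integral_congr_ae ?_) ((integral_prod_symm _ (hmass'.add hflux')).symm.trans
    (hu.integral_mul_deriv_add_eq_zero hE Q hη hχ))
  filter_upwards [hmass'.prod_left_ae, hflux'.prod_left_ae] with τ hmassτ hfluxτ
  exact ((integral_add hmassτ hfluxτ).trans
    (congrArg₂ _ (integral_mul_const _ _) (integral_mul_const _ _))).symm

end IsDistributionalSolution

lemma abs_integral_mul_laplacian_le {K : Set (Sp N)} {v : Sp N → ℝ} {c B b : ℝ}
    (hη : IsTestFunction K η) (hB : ∀ x, |Laplacian.laplacian η x| ≤ B)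
    (hv : IntegrableOn (fun x => v x - c) K volume) (hb : ∫ x in K, |v x - c| ≤ b) :
    |∫ x in K, v x * Laplacian.laplacian η x| ≤ B * b := by
  have hη2 : ContDiff ℝ 2 η := contDiff_infty.1 hη.contDiff 2
  have hΔ := continuous_laplacian hη2
  have hΔc := hasCompactSupport_laplacian hη.hasCompactSupport
  have hzero : ∫ x in K, c * Laplacian.laplacian η x = 0 := by
    rw [integral_const_mul, setIntegral_eq_integral_of_forall_compl_eq_zero
      fun x hx => laplacian_eq_zero_of_notMem fun h => hx (hη.tsupport_subset h),
      integral_laplacian hη2 hη.hasCompactSupport, mul_zero]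
  have hsub : ∫ x in K, v x * Laplacian.laplacian η x =
      ∫ x in K, (v x - c) * Laplacian.laplacian η x := by
    have hdev : IntegrableOn (fun x => (v x - c) * Laplacian.laplacian η x) K volume :=
      integrable_mul_comp_of_hasCompactSupport hv hΔ hΔc measurable_id
    rw [← add_zero (∫ x in K, (v x - c) * _), ← hzero, ← integral_add hdev
      ((hΔ.integrable_of_hasCompactSupport hΔc).const_mul c).integrableOn]
    simp only [← add_mul, sub_add_cancel]
  rw [hsub, ← Real.norm_eq_abs]
  calc ‖∫ x in K, (v x - c) * Laplacian.laplacian η x‖ ≤ ∫ x in K, B * |v x - c| :=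
        norm_integral_le_of_norm_le (hv.abs.const_mul B) (ae_of_all _ fun x => by
          rw [norm_mul, mul_comm]
          exact mul_le_mul_of_nonneg_right (hB x) (norm_nonneg _))
    _ ≤ B * b := by
        rw [integral_const_mul]
        exact mul_le_mul_of_nonneg_left hb ((abs_nonneg _).trans (hB 0))

lemma scaled_error_eq (hρ : 0 < ρ) (C a d : ℝ) (N : ℕ) :
    C / ρ ^ 2 * ((2 * ρ) ^ N * a) * d = C * 2 ^ N * a * (d / ρ ^ (2 - (N : ℝ))) := by
  rw [Real.rpow_sub hρ, Real.rpow_natCast, Real.rpow_ofNat, mul_pow]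
  field_simp

lemma IsDistributionalSolution.ae_abs_integral_sub_le (hE : IsOpen E)
    (hu : IsDistributionalSolution E T u) (hlog : HasLogBounds E T u p) (hp : 1 ≤ p)
    (Q : IsSubcylinder E T y ρ s t) (hη : IsCubeCutoff C y ρ η) :
    ∀ᵐ a ∂(volume.restrict (Ioo s t)), ∀ᵐ b ∂(volume.restrict (Ioo s t)),
      |(∫ x in cube y (2 * ρ), u x a * η x) - ∫ x in cube y (2 * ρ), u x b * η x| ≤
        C / ρ ^ 2 * ((2 * ρ) ^ N * Lam u y ρ s t p) * (t - s) := by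
  have hη' : IsTestFunction (cube y (2 * ρ)) η := hη.toIsTestFunction.mono interior_subset
  have hB : 0 ≤ C / ρ ^ 2 * ((2 * ρ) ^ N * Lam u y ρ s t p) :=
    mul_nonneg ((abs_nonneg _).trans (hη.abs_laplacian_le 0))
      (mul_nonneg (pow_nonneg (by linarith [Q.pos]) N) (Lam_nonneg u y ρ s t p))
  have hflux : ∀ᵐ τ, |(Ioc s t).indicator (fun τ => ∫ x in cube y (2 * ρ),
      Real.log (u x τ) * Laplacian.laplacian η x) τ| ≤
        C / ρ ^ 2 * ((2 * ρ) ^ N * Lam u y ρ s t p) := by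
    filter_upwards [(ae_restrict_iff' measurableSet_Ioc).1
      (hlog.ae_integral_abs_logDeviation_le Q hp)] with τ hτ
    by_cases hmem : τ ∈ Ioc s t
    · rw [indicator_of_mem hmem]
      exact abs_integral_mul_laplacian_le hη' hη.abs_laplacian_le (hτ hmem).1 (hτ hmem).2
    · rwa [indicator_of_notMem hmem, abs_zero]
  have hmass : Integrable ((Ioc s t).indicator fun τ => ∫ x in cube y (2 * ρ), u x τ * η x)
      volume :=
    (integrable_indicator_iff measurableSet_Ioc).2 (hu.integrable_mul Q hη').integral_prod_right
  filter_upwards [(hu.isWeakGradientOn_integral_mul hE Q hη').ae_abs_sub_le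
    hmass.locallyIntegrable hflux, ae_restrict_mem measurableSet_Ioo] with a hlip ha
  filter_upwards [hlip, ae_restrict_mem measurableSet_Ioo] with b hab hb
  rw [indicator_of_mem (Ioo_subset_Ioc_self ha), indicator_of_mem (Ioo_subset_Ioc_self hb)] at hab
  refine hab.trans (mul_le_mul_of_nonneg_left ?_ hB)
  exact abs_le.2 ⟨by linarith [ha.1, hb.2], by linarith [ha.2, hb.1]⟩

lemma IsDistributionalSolution.ae_mass_le (hE : IsOpen E) (hu : IsDistributionalSolution E T u)
    (hlog : HasLogBounds E T u p) (hp : 1 ≤ p) (Q : IsSubcylinder E T y ρ s t)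
    (hη : IsCubeCutoff C y ρ η) :
    ∀ᵐ a ∂(volume.restrict (Ioo s t)), ∀ᵐ b ∂(volume.restrict (Ioo s t)),
      mass u y ρ a ≤ ENNReal.ofReal (1 + C * 2 ^ N * Lam u y ρ s t p) *
        (mass u y (2 * ρ) b + ENNReal.ofReal ((t - s) / ρ ^ (2 - (N : ℝ)))) := by
  have hint : ∀ᵐ τ ∂(volume.restrict (Ioo s t)),
      IntegrableOn (fun x => u x τ * η x) (cube y (2 * ρ)) volume ∧
      ∀ᵐ x ∂(volume.restrict (cube y (2 * ρ))), 0 ≤ u x τ := by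
    rw [restrict_Ioo_eq_restrict_Ioc]
    filter_upwards [(hu.integrable_mul Q (hη.toIsTestFunction.mono interior_subset)).prod_left_ae,
      ae_slice_of_ae_prod (hu.nonnegLogFinite.ae_pos Q)] with τ hi hpos
    exact ⟨hi, hpos.mono fun x hx => hx.le⟩
  have he : 0 ≤ C * 2 ^ N * Lam u y ρ s t p :=
    mul_nonneg (mul_nonneg (hη.bound_nonneg Q.pos) (by positivity)) (Lam_nonneg u y ρ s t p)
  filter_upwards [hu.ae_abs_integral_sub_le hE hlog hp Q hη, hint] with a hab ⟨hi_a, hu_a⟩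
  filter_upwards [hab, hint] with b hb ⟨hi_b, hu_b⟩
  refine mass_le_of_integral_le (by linarith [Q.pos]) zero_le_one he hu_a hu_b hi_a
    hi_b hη.nonneg hη.le_one hη.eq_one ?_
  rw [← scaled_error_eq Q.pos]
  linarith [(abs_le.1 hb).2]

end Distributional

section ZeroExtension

variable {N : ℕ} {K : Set (Sp N)} {s t τ : ℝ} {F : Type*}

/-- The restriction of `f` to `K × [s, t]`, extended by zero to all of space-time. -/
noncomputable def zeroExtension [Zero F] (K : Set (Sp N)) (s t : ℝ) (f : Sp N → ℝ → F) :
    Sp N × ℝ → F :=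
  (K ×ˢ Icc s t).indicator fun z => f z.1 z.2

lemma zeroExtension_slice [Zero F] (f : Sp N → ℝ → F) (hτ : τ ∈ Icc s t) :
    (fun x => zeroExtension K s t f (x, τ)) = K.indicator fun x => f x τ := by
  ext x
  by_cases hx : x ∈ K
  · rw [indicator_of_mem hx, zeroExtension, indicator_of_mem (mk_mem_prod hx hτ)]
  · rw [indicator_of_notMem hx, zeroExtension, indicator_of_notMem fun h => hx h.1]

lemma ae_zeroExtension_eq [Zero F] (hK : MeasurableSet K) (f : Sp N → ℝ → F) :
    ∀ᵐ z ∂(cylinderMeasure K s t), zeroExtension K s t f z = f z.1 z.2 := by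
  rw [← restrict_prod_Icc]
  filter_upwards [ae_restrict_mem (hK.prod measurableSet_Icc)] with z hz
  exact indicator_of_mem hz _

lemma memLp_zeroExtension [NormedAddCommGroup F] {q : ℝ≥0∞} (hK : MeasurableSet K)
    {f : Sp N → ℝ → F} (hf : MemLp (fun z : Sp N × ℝ => f z.1 z.2) q (cylinderMeasure K s t)) :
    MemLp (zeroExtension K s t f) q (volume.prod volume) := by
  rw [← restrict_prod_Icc] at hf
  exact (memLp_indicator_iff_restrict (hK.prod measurableSet_Icc)).2 hf

end ZeroExtension

section StationaryTestFunction

variable {N : ℕ} {E K : Set (Sp N)} {T s t : ℝ} {φ : Sp N → ℝ}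

lemma IsTestFunction.gradient_eq_zero_of_notMem (hφ : IsTestFunction K φ) {x : Sp N}
    (hx : x ∉ K) : gradient φ x = 0 := by
  have hx' : x ∉ tsupport (fderiv ℝ φ) := fun h =>
    hx (hφ.tsupport_subset (tsupport_fderiv_subset ℝ h))
  rw [← norm_eq_zero, norm_gradient, image_eq_zero_of_notMem_tsupport hx', norm_zero]

lemma IsWeakGradient.isWeakGradientOn_indicator {w : Sp N → ℝ} {g : Sp N → Sp N}
    (hw : IsWeakGradient E w g) (hKE : K ⊆ E) :
    IsWeakGradientOn K (K.indicator w) (K.indicator g) := by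
  intro φ hφ
  have hφE : IsTestFunction E φ := hφ.mono hKE
  have h := hw φ hφE.contDiff hφE.hasCompactSupport hφE.tsupport_subset
  rw [setIntegral_eq_integral_of_forall_compl_eq_zero fun x hx => by
      rw [hφE.gradient_eq_zero_of_notMem hx, smul_zero],
    setIntegral_eq_integral_of_forall_compl_eq_zero fun x hx => by
      rw [hφE.eq_zero_of_notMem hx, zero_smul]] at h
  have hgrad : ∀ x, K.indicator w x • gradient φ x = w x • gradient φ x := fun x => by
    by_cases hx : x ∈ K
    · rw [indicator_of_mem hx]
    · rw [hφ.gradient_eq_zero_of_notMem hx, smul_zero, smul_zero]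
  have hval : ∀ x, φ x • K.indicator g x = φ x • g x := fun x => by
    by_cases hx : x ∈ K
    · rw [indicator_of_mem hx]
    · rw [hφ.eq_zero_of_notMem hx, zero_smul, zero_smul]
  simp only [hgrad, hval]
  exact h

lemma exists_isTestFunction_eq_one_deriv_eq_zero {J : Set ℝ} (hJ : IsCompact J) :
    ∃ χ, IsTestFunction univ χ ∧ ∀ τ ∈ J, χ τ = 1 ∧ deriv χ τ = 0 := by
  obtain ⟨R, hR⟩ := hJ.isBounded.subset_ball (0 : ℝ)
  let χ : ContDiffBump (0 : ℝ) := ⟨max R 1, max R 1 + 1, by positivity, by linarith⟩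
  refine ⟨χ, ⟨χ.contDiff, χ.hasCompactSupport, subset_univ _⟩, fun τ hτ => ?_⟩
  have hone : χ =ᶠ[𝓝 τ] fun _ => 1 :=
    χ.eventuallyEq_one_of_mem_ball (Metric.ball_subset_ball (le_max_left R 1) (hR hτ))
  exact ⟨hone.eq_of_nhds, by rw [hone.deriv_eq, deriv_const]⟩

lemma WeakEquation.equation_isTestFunction {u : Sp N → ℝ → ℝ} {F : Sp N → ℝ → Sp N}
    (h : WeakEquation E T u F) (hE : MeasurableSet E) (hφ : IsTestFunction E φ) {t₁ t₂ : ℝ}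
    (ht₁ : 0 < t₁) (ht : t₁ < t₂) (ht₂ : t₂ ≤ T) :
    (∫ x in E, u x t₂ * φ x) - (∫ x in E, u x t₁ * φ x) +
      ∫ z in E ×ˢ Ioc t₁ t₂, inner ℝ (F z.1 z.2) (gradient φ z.1) = 0 := by
  obtain ⟨χ, hχ, hχ1⟩ := exists_isTestFunction_eq_one_deriv_eq_zero (isCompact_Icc (a := t₁)
    (b := t₂))
  have hφχ := hφ.mul_prod hχ
  have heq := h _ hφχ.contDiff hφχ.hasCompactSupport hφχ.tsupport_subset t₁ t₂ ht₁ ht ht₂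
  simp only [(hχ1 t₁ (left_mem_Icc.2 ht.le)).1, (hχ1 t₂ (right_mem_Icc.2 ht.le)).1,
    mul_one] at heq
  rw [← heq]
  congr 1
  refine setIntegral_congr_fun (hE.prod measurableSet_Ioc) fun z hz => ?_
  obtain ⟨hχz, hχz'⟩ := hχ1 z.2 (Ioc_subset_Icc_self hz.2)
  simp only [deriv_const_mul _ (hχ.differentiable z.2), hχz, hχz', mul_zero, mul_one, zero_add]

lemma WeakEquation.equation_zeroExtension {u : Sp N → ℝ → ℝ} {F : Sp N → ℝ → Sp N}
    (h : WeakEquation E T u F) (hE : MeasurableSet E) (hKE : K ⊆ E) (hs : 0 < s) (htT : t ≤ T)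
    (hφ : IsTestFunction K φ) {t₁ t₂ : ℝ} (ht₁ : s ≤ t₁) (ht : t₁ < t₂) (ht₂ : t₂ ≤ t) :
    (∫ x, zeroExtension K s t u (x, t₂) * φ x) - (∫ x, zeroExtension K s t u (x, t₁) * φ x) +
      ∫ z, inner ℝ (zeroExtension K s t F z) (gradient φ z.1)
        ∂(volume.prod (volume.restrict (Ioc t₁ t₂))) = 0 := by
  have hslice : ∀ τ ∈ Icc s t, ∫ x, zeroExtension K s t u (x, τ) * φ x = ∫ x in E, u x τ * φ x := by
    intro τ hτ
    rw [setIntegral_eq_integral_of_forall_compl_eq_zero fun x hx => by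
      rw [(hφ.mono hKE).eq_zero_of_notMem hx, mul_zero]]
    refine integral_congr_ae (ae_of_all _ fun x => ?_)
    by_cases hx : x ∈ K
    · simp only [zeroExtension, indicator_of_mem (mk_mem_prod hx hτ)]
    · simp only [hφ.eq_zero_of_notMem hx, mul_zero]
  have hflux : ∫ z, inner ℝ (zeroExtension K s t F z) (gradient φ z.1)
      ∂(volume.prod (volume.restrict (Ioc t₁ t₂))) =
      ∫ z in E ×ˢ Ioc t₁ t₂, inner ℝ (F z.1 z.2) (gradient φ z.1) := by
    rw [prod_restrict_eq_restrict_univ_prod, setIntegral_eq_of_subset_of_forall_sdiff_eq_zero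
      (MeasurableSet.univ.prod measurableSet_Ioc) (prod_mono_left (subset_univ E)) fun z hz => ?_]
    · refine setIntegral_congr_fun (hE.prod measurableSet_Ioc) fun z hz => ?_
      by_cases hx : z.1 ∈ K
      · have hz' : z ∈ K ×ˢ Icc s t := ⟨hx, ht₁.trans hz.2.1.le, hz.2.2.trans ht₂⟩
        simp only [zeroExtension, indicator_of_mem hz']
      · simp only [hφ.gradient_eq_zero_of_notMem hx, inner_zero_right]
    · rw [(hφ.mono hKE).gradient_eq_zero_of_notMem fun hx => hz.2 ⟨hx, hz.1.2⟩, inner_zero_right]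
  rw [hslice t₁ ⟨ht₁, ht.le.trans ht₂⟩, hslice t₂ ⟨ht₁.trans ht.le, ht₂⟩, hflux]
  exact h.equation_isTestFunction hE (hφ.mono hKE) (hs.trans_le ht₁) ht (ht₂.trans htT)

end StationaryTestFunction

section Nonneg

variable {N : ℕ} {E K : Set (Sp N)} {T : ℝ} {u : Sp N → ℝ → ℝ} {y : Sp N} {ρ s t τ : ℝ}

lemma MemCLoc.ae_nonneg_of_frequently (hu : MemCLoc E T u) (hK : IsCompact K) (hKE : K ⊆ E)
    (hτ : τ ∈ Ioc 0 T)
    (hfreq : ∃ᶠ σ in 𝓝[Ioc 0 T] τ, ∀ᵐ x ∂(volume.restrict K), 0 ≤ u x σ) :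
    ∀ᵐ x ∂(volume.restrict K), 0 ≤ u x τ := by
  obtain ⟨hmem, hlim⟩ := hu K hK hKE
  have hneg : eLpNorm (fun x => max (-u x τ) 0) 2 (volume.restrict K) = 0 := by
    refine le_antisymm (ENNReal.le_of_forall_pos_le_add fun ε hε _ => ?_) zero_le
    obtain ⟨σ, hσ, hclose⟩ := (hfreq.and_eventually
      (ENNReal.tendsto_nhds_zero.1 (hlim τ hτ) ε (by exact_mod_cast hε))).exists
    rw [zero_add]
    refine (eLpNorm_mono_ae ?_).trans hclose
    filter_upwards [hσ] with x hx
    rw [Real.norm_of_nonneg (le_max_right _ _), Real.norm_eq_abs]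
    exact max_le (by linarith [le_abs_self (u x σ - u x τ)]) (abs_nonneg _)
  have hmeas : AEStronglyMeasurable (fun x => max (-u x τ) 0) (volume.restrict K) :=
    (hmem τ hτ).1.neg.sup aestronglyMeasurable_const
  filter_upwards [(eLpNorm_eq_zero_iff hmeas two_ne_zero).1 hneg] with x hx
  exact neg_nonpos.1 (max_eq_right_iff.1 hx)

lemma frequently_nhdsWithin_of_ae {P : ℝ → Prop} {J : Set ℝ}
    (hP : ∀ᵐ σ ∂(volume.restrict (Ioo s t)), P σ) (hJ : Ioo s t ⊆ J) (hτ : τ ∈ Ioo s t) :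
    ∃ᶠ σ in 𝓝[J] τ, P σ := by
  have hI : Ioo s t ∈ 𝓝 τ := isOpen_Ioo.mem_nhds hτ
  rw [ae_restrict_iff' measurableSet_Ioo] at hP
  rw [nhdsWithin_eq_nhds.2 (mem_of_superset hI hJ)]
  intro hne
  obtain ⟨σ, himp, hnot, hσ⟩ :=
    (Measure.dense_of_ae hP).inter_nhds_nonempty (inter_mem hne hI)
  exact hnot (himp hσ)

lemma MemCLoc.ae_nonneg (hu : MemCLoc E T u) (hpos : NonnegLogFinite E T u)
    (Q : IsSubcylinder E T y ρ s t) (hτ : τ ∈ Ioo s t) :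
    ∀ᵐ x ∂(volume.restrict (cube y (2 * ρ))), 0 ≤ u x τ := by
  have hJ : Ioo s t ⊆ Ioc 0 T := fun σ hσ =>
    ⟨Q.start_pos.trans hσ.1, hσ.2.le.trans Q.end_le⟩
  refine hu.ae_nonneg_of_frequently (isCompact_cube _ _) Q.cube_subset (hJ hτ)
    (frequently_nhdsWithin_of_ae ?_ hJ hτ)
  rw [restrict_Ioo_eq_restrict_Ioc]
  filter_upwards [ae_slice_of_ae_prod (hpos.ae_pos Q)] with σ hσ
  exact hσ.mono fun x hx => hx.le

end Nonneg

section Quasilinear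

variable {N : ℕ} {E : Set (Sp N)} {T Co C₁ : ℝ} {A : Sp N → ℝ → ℝ → Sp N → Sp N}
  {u : Sp N → ℝ → ℝ} {G : Sp N → ℝ → Sp N} {y : Sp N} {ρ s t τ p C : ℝ} {η : Sp N → ℝ}

/-- The flux `A(x, t, u, Du)`, where `Du = u D(ln u)` and `G` stands for `D(ln u)`. -/
def flux (A : Sp N → ℝ → ℝ → Sp N → Sp N) (u : Sp N → ℝ → ℝ) (G : Sp N → ℝ → Sp N) :
    Sp N → ℝ → Sp N :=
  fun x τ => A x τ (u x τ) (u x τ • G x τ)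

lemma StructureConditions.ae_isEllipticFlux (hA : StructureConditions E T A Co C₁)
    (hu : NonnegLogFinite E T u) (Q : IsSubcylinder E T y ρ s t) :
    ∀ᵐ z ∂(cylinderMeasure (cube y (2 * ρ)) s t),
      IsEllipticFlux Co C₁ (flux A u G z.1 z.2) (G z.1 z.2) := by
  filter_upwards [hu.ae_pos Q, ae_mono Q.cylinderMeasure_le hA.coercive,
    ae_mono Q.cylinderMeasure_le hA.growth] with z hpos hcoercive hgrowth
  have hco := hcoercive _ hpos (u z.1 z.2 • G z.1 z.2)
  have hgr := hgrowth _ hpos (u z.1 z.2 • G z.1 z.2)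
  rw [norm_smul, Real.norm_of_nonneg hpos.le] at hco hgr
  constructor
  · rw [inner_smul_right, mul_pow, sq (u z.1 z.2), mul_assoc, mul_div_cancel_left₀ _ hpos.ne',
      mul_left_comm] at hco
    exact le_of_mul_le_mul_left hco hpos
  · rwa [mul_div_cancel_left₀ _ hpos.ne'] at hgr

lemma StructureConditions.memLp_flux (hA : StructureConditions E T A Co C₁)
    (hu : HasLogBounds E T u p) (hG : MemLpLoc E T G 2) (Q : IsSubcylinder E T y ρ s t) :
    MemLp (fun z : Sp N × ℝ => flux A u G z.1 z.2) 2 (cylinderMeasure (cube y (2 * ρ)) s t) := by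
  have hu' := (hu.memLp_top.memLp_cylinderMeasure Q).1
  have hG' := hG.memLp_cylinderMeasure Q
  have hmeas : AEMeasurable (fun z : Sp N × ℝ => (z.1, z.2, u z.1 z.2, u z.1 z.2 • G z.1 z.2))
      (cylinderMeasure (cube y (2 * ρ)) s t) :=
    measurable_fst.aemeasurable.prodMk (measurable_snd.aemeasurable.prodMk
      (hu'.aemeasurable.prodMk (hu'.smul hG'.1).aemeasurable))
  exact hG'.of_le_mul (hA.measurable.comp_aemeasurable hmeas).aestronglyMeasurable
    ((hA.ae_isEllipticFlux hu.nonnegLogFinite Q).mono fun z hz => hz.growth)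

lemma isFiniteMeasure_cylinderMeasure_cube (y : Sp N) (ρ s t : ℝ) :
    IsFiniteMeasure (cylinderMeasure (cube y ρ) s t) := by
  rw [← restrict_prod_Icc]
  exact isFiniteMeasure_restrict.2 (isCompact_cube_prod_Icc y ρ s t).measure_lt_top.ne

lemma StructureConditions.logWeakSolutionOn (hE : IsOpen E)
    (hA : StructureConditions E T A Co C₁) (hu : HasLogBounds E T u p)
    (hG : MemL2W12Loc E T (fun x τ => Real.log (u x τ)) G)
    (heq : WeakEquation E T u (flux A u G)) (Q : IsSubcylinder E T y ρ s t) :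
    LogWeakSolutionOn (cube y (2 * ρ)) s t (zeroExtension (cube y (2 * ρ)) s t u)
      (zeroExtension (cube y (2 * ρ)) s t fun x τ => Real.log (u x τ))
      (zeroExtension (cube y (2 * ρ)) s t (flux A u G))
      (zeroExtension (cube y (2 * ρ)) s t G) := by
  have hK : MeasurableSet (cube y (2 * ρ)) := (isCompact_cube y (2 * ρ)).measurableSet
  have hfin := isFiniteMeasure_cylinderMeasure_cube y (2 * ρ) s t
  refine ⟨memLp_zeroExtension hK ((hu.memLp_top.memLp_cylinderMeasure Q).mono_exponent le_top),
    memLp_zeroExtension hK (hG.memLp.memLp_cylinderMeasure Q),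
    memLp_zeroExtension hK (hA.memLp_flux hu hG.memLp_grad Q),
    memLp_zeroExtension hK (hG.memLp_grad.memLp_cylinderMeasure Q), ?_,
    fun φ hφ t₁ t₂ ht₁ ht ht₂ => heq.equation_zeroExtension hE.measurableSet Q.cube_subset
      Q.start_pos Q.end_le hφ ht₁ ht ht₂, ?_⟩
  · filter_upwards [ae_restrict_of_ae_restrict_of_subset
      (Ioc_subset_Ioc Q.start_pos.le Q.end_le) hG.weakGradient,
      ae_restrict_mem measurableSet_Ioc] with τ hgrad hτ
    rw [zeroExtension_slice _ (Ioc_subset_Icc_self hτ),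
      zeroExtension_slice _ (Ioc_subset_Icc_self hτ)]
    exact hgrad.isWeakGradientOn_indicator Q.cube_subset
  · filter_upwards [hu.nonnegLogFinite.ae_pos Q, ae_zeroExtension_eq hK u,
      ae_zeroExtension_eq hK fun x τ => Real.log (u x τ)] with z hpos hu_eq hlog_eq
    rw [hu_eq, hlog_eq]
    exact ⟨hpos, rfl⟩

lemma HasLogBounds.integral_one_add_sq_logDeviation_le (hu : HasLogBounds E T u p)
    (hlog : MemLpLoc E T (fun x τ => Real.log (u x τ)) 2) (Q : IsSubcylinder E T y ρ s t)
    (hp : 2 ≤ p) :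
    ∫ z, (1 + logDeviation u y ρ s t z.1 z.2 ^ 2) ∂(cylinderMeasure (cube y (2 * ρ)) s t) ≤
      (2 * ρ) ^ N * (1 + Lam u y ρ s t 2 ^ 2) * (t - s) := by
  have hfin := isFiniteMeasure_cylinderMeasure_cube y (2 * ρ) s t
  have hi : Integrable (fun z : Sp N × ℝ => 1 + logDeviation u y ρ s t z.1 z.2 ^ 2)
      (cylinderMeasure (cube y (2 * ρ)) s t) :=
    (integrable_const _).add ((hlog.memLp_cylinderMeasure Q).sub (memLp_const _)).integrable_sq
  rw [cylinderMeasure, integral_prod_symm _ hi]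
  refine (integral_mono_ae hi.integral_prod_right (integrable_const _)
    (hu.ae_integral_one_add_sq_logDeviation_le Q hp)).trans_eq ?_
  rw [setIntegral_const, Real.volume_real_Ioc_of_le Q.lt.le, smul_eq_mul, mul_comm]

lemma IsLocalWeakSolutionQuasilinear.integral_mul_sq_le (hCo : 0 < Co) (hC₁ : 0 ≤ C₁)
    (hE : IsOpen E) (hA : StructureConditions E T A Co C₁)
    (hu : IsLocalWeakSolutionQuasilinear E T A u) (hlog : HasLogBounds E T u p) (hp : 2 ≤ p)
    (Q : IsSubcylinder E T y ρ s t) (hη : IsCubeCutoff C y ρ η) {a b : ℝ} (ha : a ∈ Icc s t)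
    (hb : b ∈ Icc s t) :
    ∫ x in cube y (2 * ρ), u x a * (η x * η x) ≤
      5 / 3 * (∫ x in cube y (2 * ρ), u x b * (η x * η x)) +
        24 * C₁ ^ 2 / Co * ((C / ρ) ^ 2 * ((2 * ρ) ^ N * (1 + Lam u y ρ s t 2 ^ 2) * (t - s))) := by
  obtain ⟨G, hG, heq⟩ := hu.exists_grad
  have hK : MeasurableSet (cube y (2 * ρ)) := (isCompact_cube y (2 * ρ)).measurableSet
  have hslice : ∀ τ ∈ Icc s t, ∫ x, zeroExtension (cube y (2 * ρ)) s t u (x, τ) * (η x * η x) =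
      ∫ x in cube y (2 * ρ), u x τ * (η x * η x) := fun τ hτ => by
    rw [← integral_indicator hK]
    simp only [indicator_mul_left, ← zeroExtension_slice (K := cube y (2 * ρ)) u hτ]
  have hflux : ∀ᵐ z ∂(cylinderMeasure (cube y (2 * ρ)) s t), IsEllipticFlux Co C₁
      (zeroExtension (cube y (2 * ρ)) s t (flux A u G) z)
      (zeroExtension (cube y (2 * ρ)) s t G z) := by
    filter_upwards [hA.ae_isEllipticFlux (G := G) hlog.nonnegLogFinite Q,
      ae_zeroExtension_eq hK (flux A u G), ae_zeroExtension_eq hK G] with z hz hF_eq hG_eq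
    rwa [hF_eq, hG_eq]
  have hdev : ∫ z, (1 + (zeroExtension (cube y (2 * ρ)) s t (fun x τ => Real.log (u x τ)) z -
      Real.log (supM u y ρ s t)) ^ 2) ∂(cylinderMeasure (cube y (2 * ρ)) s t) ≤
      (2 * ρ) ^ N * (1 + Lam u y ρ s t 2 ^ 2) * (t - s) := by
    refine (integral_congr_ae ?_).trans_le
      (hlog.integral_one_add_sq_logDeviation_le hG.memLp Q hp)
    filter_upwards [ae_zeroExtension_eq hK fun x τ => Real.log (u x τ)] with z hz
    rw [hz, logDeviation]
  rw [← hslice a ha, ← hslice b hb]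
  exact (hA.logWeakSolutionOn hE hlog hG heq Q).mass_le (volume_cube_ne_top y _) Q.lt hCo hC₁
    hflux hη.toIsTestFunction hη.nonneg hη.norm_gradient_le hdev ha hb

lemma IsLocalWeakSolutionQuasilinear.mass_le (hCo : 0 < Co) (hC₁ : 0 ≤ C₁) (hE : IsOpen E)
    (hA : StructureConditions E T A Co C₁) (hu : IsLocalWeakSolutionQuasilinear E T A u)
    (hlog : HasLogBounds E T u p) (hp : 2 ≤ p) (Q : IsSubcylinder E T y ρ s t)
    (hη : IsCubeCutoff C y ρ η) {a b : ℝ} (ha : a ∈ Ioo s t) (hb : b ∈ Ioo s t) :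
    mass u y ρ a ≤
      ENNReal.ofReal (5 / 3 + 24 * C₁ ^ 2 / Co * C ^ 2 * 2 ^ N * (1 + Lam u y ρ s t 2 ^ 2)) *
        (mass u y (2 * ρ) b + ENNReal.ofReal ((t - s) / ρ ^ (2 - (N : ℝ)))) := by
  have hη2 : IsTestFunction (interior (cube y (2 * ρ))) fun x => η x * η x :=
    hη.toIsTestFunction.mul_left hη.contDiff
  have hi : ∀ τ ∈ Ioo s t, IntegrableOn (fun x => u x τ * (η x * η x)) (cube y (2 * ρ)) volume :=
    fun τ hτ => ((hu.memCLoc _ (isCompact_cube y (2 * ρ)) Q.cube_subset).1 τ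
      ⟨Q.start_pos.trans hτ.1, hτ.2.le.trans Q.end_le⟩).integrable_mul (hη2.memLp (p := 2))
  have hnonneg : ∀ τ ∈ Ioo s t, ∀ᵐ x ∂(volume.restrict (cube y (2 * ρ))), 0 ≤ u x τ :=
    fun τ hτ => hu.memCLoc.ae_nonneg hu.nonnegLogFinite Q hτ
  have herror : 24 * C₁ ^ 2 / Co * ((C / ρ) ^ 2 *
      ((2 * ρ) ^ N * (1 + Lam u y ρ s t 2 ^ 2) * (t - s))) =
      24 * C₁ ^ 2 / Co * C ^ 2 * 2 ^ N * (1 + Lam u y ρ s t 2 ^ 2) *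
        ((t - s) / ρ ^ (2 - (N : ℝ))) := by
    rw [← scaled_error_eq Q.pos, div_pow]
    ring
  refine mass_le_of_integral_le (by linarith [Q.pos]) (by norm_num) (by positivity)
    (hnonneg a ha) (hnonneg b hb) (hi a ha) (hi b hb) (fun x => mul_self_nonneg _)
    (fun x => mul_le_one₀ (hη.le_one x) (hη.nonneg x) (hη.le_one x))
    (fun x hx => by rw [hη.eq_one x hx, mul_one]) ?_
  rw [← herror]
  exact hu.integral_mul_sq_le hCo hC₁ hE hA hlog hp Q hη (Ioo_subset_Icc_self ha)
    (Ioo_subset_Icc_self hb)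

end Quasilinear

section Suprema

variable {α : Type*} {f g : α → ℝ≥0∞} {k m : ℝ≥0∞}

lemma le_mul_add_iff_div_tsub_le {a b : ℝ≥0∞} (hk₀ : k ≠ 0) (hk : k ≠ ⊤) :
    a ≤ k * (b + m) ↔ a / k - m ≤ b := by
  rw [tsub_le_iff_right, ENNReal.div_le_iff' hk₀ hk]

lemma iSup_le_mul_iInf_add {J : Set α} (hk₀ : k ≠ 0) (hk : k ≠ ⊤)
    (h : ∀ a ∈ J, ∀ b ∈ J, f a ≤ k * (g b + m)) :
    (⨆ a ∈ J, f a) ≤ k * ((⨅ b ∈ J, g b) + m) :=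
  iSup₂_le fun a ha => (le_mul_add_iff_div_tsub_le hk₀ hk).2 <| le_iInf₂ fun b hb =>
    (le_mul_add_iff_div_tsub_le hk₀ hk).1 (h a ha b hb)

lemma essSup_le_mul_essInf_add [MeasurableSpace α] {μ : Measure α} (hk₀ : k ≠ 0) (hk : k ≠ ⊤)
    (h : ∀ᵐ a ∂μ, ∀ᵐ b ∂μ, f a ≤ k * (g b + m)) :
    essSup f μ ≤ k * (essInf g μ + m) :=
  essSup_le_of_ae_le _ <| h.mono fun _ ha => (le_mul_add_iff_div_tsub_le hk₀ hk).2 <|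
    le_essInf_of_ae_le _ <| ha.mono fun _ hb => (le_mul_add_iff_div_tsub_le hk₀ hk).1 hb

end Suprema

section Equation

variable {N : ℕ}

lemma structureConditions_inv_smul (E : Set (Sp N)) (T : ℝ) :
    StructureConditions E T (fun _ _ v ξ => v⁻¹ • ξ) 1 1 where
  measurable := by fun_prop
  coercive := ae_of_all _ fun _ v _ ξ => by
    rw [real_inner_smul_left, real_inner_self_eq_norm_sq, one_mul, div_eq_inv_mul]
  growth := ae_of_all _ fun _ v hv ξ => by
    rw [norm_smul, norm_inv, Real.norm_of_nonneg hv.le, one_mul, div_eq_inv_mul]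

lemma IsLocalWeakSolution.isLocalWeakSolutionQuasilinear {E : Set (Sp N)} {T : ℝ}
    {u : Sp N → ℝ → ℝ} (hu : IsLocalWeakSolution E T u) :
    IsLocalWeakSolutionQuasilinear E T (fun _ _ v ξ => v⁻¹ • ξ) u := by
  obtain ⟨G, hG, heq⟩ := hu.exists_grad
  refine ⟨hu.nonnegLogFinite, hu.memCLoc, G, hG, fun φ hφ hφc hφE t₁ t₂ ht₁ ht ht₂ => ?_⟩
  rw [← heq φ hφ hφc hφE t₁ t₂ ht₁ ht ht₂]
  congr 1
  have hsub : E ×ˢ Ioc t₁ t₂ ⊆ cyl E T := prod_mono_right (Ioc_subset_Ioc ht₁.le ht₂)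
  refine integral_congr_ae ?_
  filter_upwards [ae_restrict_of_ae_restrict_of_subset hsub hu.nonnegLogFinite.ne_zero] with z hz
  rw [inv_smul_smul₀ hz]

end Equation

end LogDiffusion

open LogDiffusion in
theorem proposition2p1_general (N : ℕ) :
    (∀ Co C₁ : ℝ, 0 < Co → 0 < C₁ → ∃ γ : ℝ → ℝ, (∀ a, 0 < γ a) ∧
      ∀ (E : Set (Sp N)) (T p : ℝ) (A : Sp N → ℝ → ℝ → Sp N → Sp N) (u : Sp N → ℝ → ℝ),
        2 ≤ p → IsOpen E → StructureConditions E T A Co C₁ →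
        IsLocalWeakSolutionQuasilinear E T A u → MemLpLoc E T u ⊤ →
        MemLinftyLpLoc E T (fun x τ => Real.log (u x τ)) p →
        ∀ (y : Sp N) (ρ s t : ℝ), 0 < ρ → s < t → cube y (2 * ρ) ×ˢ Icc s t ⊆ cyl E T →
          (⨆ τ ∈ Ioo s t, mass u y ρ τ) ≤ ENNReal.ofReal (γ (Lam u y ρ s t 2)) *
            ((⨅ τ ∈ Ioo s t, mass u y (2 * ρ) τ) +
              ENNReal.ofReal ((t - s) / ρ ^ (2 - (N : ℝ))))) ∧
    (∃ γ : ℝ → ℝ, (∀ a, 0 < γ a) ∧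
      ∀ (E : Set (Sp N)) (T p : ℝ) (u : Sp N → ℝ → ℝ),
        1 ≤ p → IsOpen E → IsDistributionalSolution E T u → MemLpLoc E T u ⊤ →
        MemLinftyLpLoc E T (fun x τ => Real.log (u x τ)) p →
        ∀ (y : Sp N) (ρ s t : ℝ), 0 < ρ → s < t → cube y (2 * ρ) ×ˢ Icc s t ⊆ cyl E T →
          essSup (fun τ => mass u y ρ τ) (volume.restrict (Ioo s t)) ≤
            ENNReal.ofReal (γ (Lam u y ρ s t p)) *
              (essInf (fun τ => mass u y (2 * ρ) τ) (volume.restrict (Ioo s t)) +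
                ENNReal.ofReal ((t - s) / ρ ^ (2 - (N : ℝ))))) := by
  obtain ⟨C, η, hη⟩ := exists_isCubeCutoff_one N
  have hC : 0 ≤ C := hη.bound_nonneg one_pos
  constructor
  · intro Co C₁ hCo hC₁
    refine ⟨fun Λ => 5 / 3 + 24 * C₁ ^ 2 / Co * C ^ 2 * 2 ^ N * (1 + Λ ^ 2),
      fun Λ => by positivity, fun E T p A u hp hE hA hu hb hlog y ρ s t hρ hst hsub => ?_⟩
    exact iSup_le_mul_iInf_add (ENNReal.ofReal_pos.2 (by positivity)).ne' ENNReal.ofReal_ne_top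
      fun τ₁ hτ₁ τ₂ hτ₂ => hu.mass_le hCo hC₁.le hE hA ⟨hu.nonnegLogFinite, hb, hlog⟩ hp
        ⟨hρ, hst, hsub⟩ (hη.rescale y hρ) hτ₁ hτ₂
  · refine ⟨fun Λ => 1 + C * 2 ^ N * |Λ|, fun Λ => by positivity,
      fun E T p u hp hE hu hb hlog y ρ s t hρ hst hsub => ?_⟩
    have hΛ : 0 ≤ Lam u y ρ s t p := Lam_nonneg u y ρ s t p
    beta_reduce
    rw [abs_of_nonneg hΛ]
    exact essSup_le_mul_essInf_add (ENNReal.ofReal_pos.2 (by positivity)).ne' ENNReal.ofReal_ne_top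
      (hu.ae_mass_le hE ⟨hu.nonnegLogFinite, hb, hlog⟩ hp ⟨hρ, hst, hsub⟩ (hη.rescale y hρ))

theorem proposition2p1 :
    -- weak solutions of `u_t - Δ ln u = 0`
    (∀ (N : ℕ) (r p : ℝ), 1 ≤ N → max 1 ((N : ℝ) / 2) < r → 2 ≤ p →
      ∃ γ : ℝ → ℝ → ℝ, (∀ a b, 0 < γ a b) ∧
        ∀ (E : Set (LogDiffusion.Sp N)) (T : ℝ) (u : LogDiffusion.Sp N → ℝ → ℝ),
          IsOpen E → 0 < T →
          LogDiffusion.IsLocalWeakSolution E T u →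
          LogDiffusion.MemLpLoc E T u ⊤ →
          LogDiffusion.MemLpLoc E T u (ENNReal.ofReal r) →
          LogDiffusion.MemLinftyLpLoc E T (fun x τ => Real.log (u x τ)) p →
          ∀ (y : LogDiffusion.Sp N) (ρ s t : ℝ), 0 < ρ → s < t →
            LogDiffusion.cube y (2 * ρ) ×ˢ Set.Icc s t ⊆ LogDiffusion.cyl E T →
            (⨆ τ ∈ Set.Ioo s t, LogDiffusion.mass u y ρ τ) ≤
              ENNReal.ofReal
                  (γ (LogDiffusion.Lam u y ρ s t 1) (LogDiffusion.Lam u y ρ s t 2)) *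
                ((⨅ τ ∈ Set.Ioo s t, LogDiffusion.mass u y (2 * ρ) τ) +
                  ENNReal.ofReal ((t - s) / ρ ^ (2 - (N : ℝ))))) ∧
    -- weak solutions of `u_t - div A(x, t, u, Du) = 0`
    (∀ (N : ℕ) (r p Co C1 : ℝ), 1 ≤ N → max 1 ((N : ℝ) / 2) < r → 2 ≤ p → 0 < Co → 0 < C1 →
      ∃ γ : ℝ → ℝ → ℝ, (∀ a b, 0 < γ a b) ∧
        ∀ (E : Set (LogDiffusion.Sp N)) (T : ℝ)
          (A : LogDiffusion.Sp N → ℝ → ℝ → LogDiffusion.Sp N → LogDiffusion.Sp N)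
          (u : LogDiffusion.Sp N → ℝ → ℝ),
          IsOpen E → 0 < T →
          LogDiffusion.StructureConditions E T A Co C1 →
          LogDiffusion.IsLocalWeakSolutionQuasilinear E T A u →
          LogDiffusion.MemLpLoc E T u ⊤ →
          LogDiffusion.MemLpLoc E T u (ENNReal.ofReal r) →
          LogDiffusion.MemLinftyLpLoc E T (fun x τ => Real.log (u x τ)) p →
          ∀ (y : LogDiffusion.Sp N) (ρ s t : ℝ), 0 < ρ → s < t →
            LogDiffusion.cube y (2 * ρ) ×ˢ Set.Icc s t ⊆ LogDiffusion.cyl E T →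
            (⨆ τ ∈ Set.Ioo s t, LogDiffusion.mass u y ρ τ) ≤
              ENNReal.ofReal
                  (γ (LogDiffusion.Lam u y ρ s t 1) (LogDiffusion.Lam u y ρ s t 2)) *
                ((⨅ τ ∈ Set.Ioo s t, LogDiffusion.mass u y (2 * ρ) τ) +
                  ENNReal.ofReal ((t - s) / ρ ^ (2 - (N : ℝ))))) ∧
    -- distributional solutions of `u_t - Δ ln u = 0`; these are defined only a.e. in time
    (∀ N : ℕ, 1 ≤ N →
      ∃ γ : ℝ → ℝ, (∀ a, 0 < γ a) ∧
        ∀ (r p : ℝ), max 1 ((N : ℝ) / 2) < r → 1 < p →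
        ∀ (E : Set (LogDiffusion.Sp N)) (T : ℝ) (u : LogDiffusion.Sp N → ℝ → ℝ),
          IsOpen E → 0 < T →
          LogDiffusion.IsDistributionalSolution E T u →
          LogDiffusion.MemLpLoc E T u ⊤ →
          LogDiffusion.MemLpLoc E T u (ENNReal.ofReal r) →
          LogDiffusion.MemLinftyLpLoc E T (fun x τ => Real.log (u x τ)) p →
          ∀ (y : LogDiffusion.Sp N) (ρ s t : ℝ), 0 < ρ → s < t →
            LogDiffusion.cube y (2 * ρ) ×ˢ Set.Icc s t ⊆ LogDiffusion.cyl E T →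
            essSup (fun τ => LogDiffusion.mass u y ρ τ)
                (MeasureTheory.volume.restrict (Set.Ioo s t)) ≤
              ENNReal.ofReal (γ (LogDiffusion.Lam u y ρ s t p)) *
                (essInf (fun τ => LogDiffusion.mass u y (2 * ρ) τ)
                    (MeasureTheory.volume.restrict (Set.Ioo s t)) +
                  ENNReal.ofReal ((t - s) / ρ ^ (2 - (N : ℝ))))) := by
  refine ⟨fun N _ p _ _ hp => ?_, fun N _ p Co C1 _ _ hp hCo hC1 => ?_, fun N _ => ?_⟩
  · obtain ⟨γ, hγ, h⟩ := (proposition2p1_general N).1 1 1 one_pos one_pos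
    exact ⟨fun _ Λ => γ Λ, fun _ => hγ, fun E T u hE _ hu hb _ hlog => h E T p _ u hp hE
      (LogDiffusion.structureConditions_inv_smul E T) hu.isLocalWeakSolutionQuasilinear hb hlog⟩
  · obtain ⟨γ, hγ, h⟩ := (proposition2p1_general N).1 Co C1 hCo hC1
    exact ⟨fun _ Λ => γ Λ, fun _ => hγ,
      fun E T A u hE _ hA hu hb _ hlog => h E T p A u hp hE hA hu hb hlog⟩
  · obtain ⟨γ, hγ, h⟩ := (proposition2p1_general N).2
    exact ⟨γ, hγ, fun _ p _ hp E T u hE _ hu hb _ hlog => h E T p u hp.le hE hu hb hlog⟩
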